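/- Setting. Let $\mathcal Y\subset\mathbb R$ and let $L:\mathcal Y\times\mathbb R\to[0,\infty)$ be a loss, measurable in $y$, such that (1) $L(y,\cdot)$ is convex and $L(y,w)\le c_1(|y|^q+|w|^q)$ for all $y\in\mathcal Y$, $w\in\mathbb R$, with constants $c_1>0$, $q\ge1$; (2) for every $R\ge0$ there is $c_2>0$ with $|L(y,w)-L(y,w')|\le c_2|w-w'|$ for all $w,w'\in[-R,R]$ and $y\in\mathcal Y$. For every sample size $n$ let $p_n\ge1$, let $\mathcal X_n\subset\mathbb R^{p_n}$ be compact and contained in the closure of its interior, let $\rho_n$ be a probability law of $(x,y)\in\mathcal X_n\times\mathcal Y$ with $E|y|<\infty$, and let $\mathcal H_n$ be a reproducing kernel Hilbert space of real functions on $\mathcal X_n$ with kernel $K$ and norm $\|\cdot\|_K$. Each $K(\cdot,y)$ is continuous on $\mathcal X_n$, with partial derivatives in the interior that extend continuously to $\mathcal X_n$ (partial derivatives at boundary points are these extensions). Write $K_x=K(x,\cdot)$, $\partial_lK_x=\partial K(x,\cdot)/\partial x^l$. Let - $f^*_n\in\mathcal H_n$ have least norm among the minimizers over $\mathcal H_n$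 of the expected error $\mathcal E(f)=E\,L(y,f(x))$, where $\mathcal E(f_n^*)<\infty$ and $\sup_n\|f_n^*\|_K<\infty$; - $\lambda_n=n^{-1/(4q)}$, and $\widetilde f_n$ be the minimizer over $\mathcal H_n$ of $\mathcal E(f)+\lambda_n\|f\|_K^2$; - $\widehat f_n$ be the minimizer over $\mathcal H_n$ of $\frac1n\sum_{i=1}^nL(y_i,f(x_i))+\lambda_n\|f\|_K^2$, where $(x_i,y_i)_{i\le n}$ are independent with law $\rho_n$. For $l\le p_n$ put $g^*_l=\partial f^*_n/\partial x^l$, $\widehat g_l=\partial\widehat f_n/\partial x^l$, $\|g^*_l\|_2^2=E\,g_l^*(x)^2$, $\|\widehat g_l\|_n^2=\frac1n\sum_{i=1}^n\widehat g_l(x_i)^2$, $\mathcal A^*=\{l:\|g_l^*\|_2^2>0\}$ and $\widehat{\mathcal A}_{v}=\{l:\|\widehat g_l\|_n^2>v\}$. Theorem. Suppose, with positive constants $\kappa_1,\kappa_2,c_3,\theta,c_5$ and $\xi>1/2$ not depending on $n$: 1. $\sup_{x}\|K_x\|_K\le\kappa_1$, and $\partial_lK_x\in\mathcal H_n$ with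 $\sup_x\|\partial_lK_x\|_K\le\kappa_2$ for all $l\le p_n$; 2. $\|\widetilde f_n-f^*_n\|_K\le c_3\lambda_n^\theta$ for all $n\ge1$; 3. for all large $n$, $\delta_n\in(0,1)$, $\delta_n\ge2(\log n)^{-1/q}E|y|$, and for every $l\in\mathcal A^*$ $$\|g^*_l\|_2^2>c_5\Big(\log\frac{4p_n}{\delta_n}\Big)^{\xi}\max\big\{(\log n)^{q/2}n^{-3/16},\,n^{-\theta/(4q)}\big\}.$$ Then $P(\widehat{\mathcal A}_{v_n}=\mathcal A^*)\to1$ as $n\to\infty$, both for $$v_n=\frac{c_5}{2}\Big(\log\frac{4}{\delta_n}\Big)^{\xi}\max\big\{(\log n)^{q/2}n^{-3/16},\,n^{-\theta/(4q)}\big\}$$ and for $$v_n=\frac{c_5}{2}\Big(\log\frac{4p_n}{\delta_n}\Big)^{\xi}\max\big\{(\log n)^{q/2}n^{-3/16},\,n^{-\theta/(4q)}\big\}.$$ -/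

import Mathlib

open MeasureTheory Filter Topology

namespace SparseRKHS

noncomputable section

/-- The conditions on the loss `L : 𝒴 × ℝ → ℝ⁺`: convexity in the second argument, growth of
order `q`, and local Lipschitz continuity uniformly in `y`. -/
structure AdmissibleLoss (𝒴 : Set ℝ) (L : 𝒴 → ℝ → ℝ) (c₁ q : ℝ) : Prop where
  measurable : ∀ w : ℝ, Measurable fun y : 𝒴 => L y w
  nonneg : ∀ (y : 𝒴) (w : ℝ), 0 ≤ L y w
  convex : ∀ y : 𝒴, ConvexOn ℝ Set.univ (L y)
  growth : ∀ (y : 𝒴) (w : ℝ), L y w ≤ c₁ * (|(y : ℝ)| ^ q + |w| ^ q)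
  lipschitz : ∀ R : ℝ, 0 ≤ R → ∃ c₂ : ℝ, 0 < c₂ ∧
    ∀ (y : 𝒴), ∀ w ∈ Set.Icc (-R) R, ∀ w' ∈ Set.Icc (-R) R,
      |L y w - L y w'| ≤ c₂ * |w - w'|

section Derivatives

variable {p : ℕ} {𝒳 : Set (EuclideanSpace ℝ (Fin p))}

/-- Extension by zero of a function on `𝒳`; it only serves to differentiate at interior points. -/
def extendZero (f : 𝒳 → ℝ) : EuclideanSpace ℝ (Fin p) → ℝ :=
  Function.extend Subtype.val f 0

/-- `f` is of class `C¹` on `𝒳` coordinatewise: it is continuous on `𝒳`, and each partial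
derivative exists in the interior of `𝒳` and extends continuously to `𝒳`. -/
def HasContinuousPartials (f : 𝒳 → ℝ) : Prop :=
  Continuous f ∧ ∀ l : Fin p, ∃ g : 𝒳 → ℝ, Continuous g ∧
    ∀ x : 𝒳, (x : EuclideanSpace ℝ (Fin p)) ∈ interior 𝒳 →
      HasLineDerivAt ℝ (extendZero f) (g x) (x : EuclideanSpace ℝ (Fin p))
        (EuclideanSpace.single l 1)

/-- The partial derivative `∂f/∂x^l` at `x ∈ 𝒳`: the usual one in the interior of `𝒳`, and its
continuous extension at the boundary points. -/
def partialDeriv (l : Fin p) (f : 𝒳 → ℝ) (x : 𝒳) : ℝ :=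
  extendFrom (interior 𝒳)
    (fun z => lineDeriv ℝ (extendZero f) z (EuclideanSpace.single l 1)) x

end Derivatives

section Kernel

variable {X : Type*} (H : Type*) [NormedAddCommGroup H] [InnerProductSpace ℝ H]
  [CompleteSpace H] [RKHS ℝ H X ℝ]

/-- The kernel section `K_x = K(x, ·)`, as an element of the RKHS. -/
def kerSection (x : X) : H := RKHS.kerFun H x (1 : ℝ)

end Kernel

section Objectives

variable {p : ℕ} {𝒳 : Set (EuclideanSpace ℝ (Fin p))} {𝒴 : Set ℝ} {H : Type*}
  [NormedAddCommGroup H] [InnerProductSpace ℝ H] [CompleteSpace H] [RKHS ℝ H 𝒳 ℝ]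

/-- `sup_x ‖K_x‖_K ≤ κ₁`, and for every coordinate `l` the functions
`∂_l K_x = ∂K(x, ·)/∂x^l` belong to the RKHS and satisfy `sup_x ‖∂_l K_x‖_K ≤ κ₂`. -/
def BoundedKernel (𝒳 : Set (EuclideanSpace ℝ (Fin p))) (H : Type*) [NormedAddCommGroup H]
    [InnerProductSpace ℝ H] [CompleteSpace H] [RKHS ℝ H 𝒳 ℝ] (κ₁ κ₂ : ℝ) : Prop :=
  (∀ x : 𝒳, ‖kerSection H x‖ ≤ κ₁) ∧
  ∀ (l : Fin p) (x : 𝒳), ∃ k : H,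
    (∀ y : 𝒳, k y = partialDeriv l (fun x' : 𝒳 => kerSection H x' y) x) ∧ ‖k‖ ≤ κ₂

/-- The expected error `E L(y, f(x))` under the law `ρ` of `(x, y)`. -/
def risk (L : 𝒴 → ℝ → ℝ) (ρ : Measure (𝒳 × 𝒴)) (f : H) : ℝ :=
  ∫ z, L z.2 (f z.1) ∂ρ

/-- The target: an element of the RKHS that has finite expected error, minimizes the expected
error over the RKHS, and has least norm among all such minimizers. -/
structure IsTarget (L : 𝒴 → ℝ → ℝ) (ρ : Measure (𝒳 × 𝒴)) (f : H) : Prop where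
  integrable : Integrable (fun z => L z.2 (f z.1)) ρ
  isMin : ∀ h : H, risk L ρ f ≤ risk L ρ h
  norm_le : ∀ f' : H, (∀ h : H, risk L ρ f' ≤ risk L ρ h) → ‖f‖ ≤ ‖f'‖

/-- `f` minimizes the regularized expected error. -/
def IsRegularizedMinimizer (L : 𝒴 → ℝ → ℝ) (ρ : Measure (𝒳 × 𝒴)) (lam : ℝ) (f : H) : Prop :=
  ∀ h : H, risk L ρ f + lam * ‖f‖ ^ 2 ≤ risk L ρ h + lam * ‖h‖ ^ 2

/-- The empirical error of `f` on the sample `z`. -/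
def empRisk (L : 𝒴 → ℝ → ℝ) {n : ℕ} (z : Fin n → 𝒳 × 𝒴) (f : H) : ℝ :=
  (1 / (n : ℝ)) * ∑ i, L (z i).2 (f (z i).1)

/-- `f` is the regularized M-estimator computed from the sample `z`. -/
def IsMEstimator (L : 𝒴 → ℝ → ℝ) (lam : ℝ) {n : ℕ} (z : Fin n → 𝒳 × 𝒴) (f : H) : Prop :=
  ∀ h : H, empRisk L z f + lam * ‖f‖ ^ 2 ≤ empRisk L z h + lam * ‖h‖ ^ 2

/-- `‖∂_l f‖₂²`, the squared norm in `L²` of the marginal law of `x`. -/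
def gradNormSq (ρ : Measure (𝒳 × 𝒴)) (l : Fin p) (f : H) : ℝ :=
  ∫ x, (partialDeriv l (fun x : 𝒳 => f x) x) ^ 2 ∂(ρ.map Prod.fst)

/-- `‖∂_l f‖_n²`, the squared empirical norm. -/
def gradEmpNormSq {n : ℕ} (z : Fin n → 𝒳 × 𝒴) (l : Fin p) (f : H) : ℝ :=
  (1 / (n : ℝ)) * ∑ i, (partialDeriv l (fun x : 𝒳 => f x) (z i).1) ^ 2

/-- The true active set `{l : ‖g*_l‖₂² > 0}`. -/
def activeSet (ρ : Measure (𝒳 × 𝒴)) (fstar : H) : Set (Fin p) :=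
  {l | 0 < gradNormSq ρ l fstar}

/-- The estimated active set `{l : ‖ĝ_l‖_n² > v}`. -/
def selectedSet {n : ℕ} (z : Fin n → 𝒳 × 𝒴) (fhat : H) (v : ℝ) : Set (Fin p) :=
  {l | v < gradEmpNormSq z l fhat}

end Objectives

/-- The regularization parameter `λ_n = n^{-1/(4q)}`. -/
def regParam (q : ℝ) (n : ℕ) : ℝ := (n : ℝ) ^ (-(1 / (4 * q)))

/-- The rate `max {(log n)^{q/2} n^{-3/16}, n^{-θ/(4q)}}`. -/
def rate (q θ : ℝ) (n : ℕ) : ℝ :=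
  max (Real.log n ^ (q / 2) * (n : ℝ) ^ (-(3 / 16 : ℝ))) ((n : ℝ) ^ (-(θ / (4 * q))))

end

end SparseRKHS

open SparseRKHS

/-! Everything reduces to a bound on `‖fhat - fstar‖` in the RKHS norm. Pairing with `∂_l K_x`,
whose norm is at most `κ₂`, represents `∂f/∂x^l`, so this one bound controls all partial derivatives
at all points simultaneously, without a union bound over coordinates.

For the bound, let `s` be a measurable choice of subgradients of the loss at `ftilde` with `E[s K_x]
= -2λ ftilde` (`exists_subgradient_selection`). Convexity of the loss and the quadratic penalty give
`λ‖fhat - ftilde‖ ≤ ‖(1/n) ∑ (s K_x + 2λ ftilde)‖` (`norm_sub_le_of_isMin`). The summands are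
centred and bounded, so Chebyshev in Hilbert space applies. Only the loss near `ftilde` matters, and
`‖ftilde‖ ≤ M + c₃` for all `n`, so one Lipschitz constant suffices. With radius `n^(-1/8)` the
failure probability is `O(n^(-1/4))`, and the approximation error adds `c₃ λ^θ`.

The resulting squared derivative error is `o(rate)`. On an inactive coordinate `g*_l` vanishes
almost surely, so its empirical norm stays below the threshold. On an active one, Hoeffding keeps
the empirical second moment of `g*_l` above three quarters of its mean (`measure_selection_ge`). The
union bound costs a factor `p_n`, absorbed because the squared signal carries `(log (4
p_n/δ_n))^(2ξ)` with `2ξ > 1`. -/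

namespace SparseRKHS

/-! ### Directional derivatives of convex functions on the line -/

section Subgradient

/-- The directional derivative of a convex function `g` at `w` in the direction `a`. -/
noncomputable def dirDeriv (g : ℝ → ℝ) (w a : ℝ) : ℝ :=
  max (derivWithin g (Set.Ioi w) w * a) (derivWithin g (Set.Iio w) w * a)

/-- According to the sign of `a`, the quotient is `a` times a slope taken from the right or from the
left; since the left derivative is at most the right one, the maximum in `dirDeriv` selects the
matching side. -/
lemma tendsto_dirDeriv {g : ℝ → ℝ} (hg : ConvexOn ℝ Set.univ g) (w a : ℝ) :
    Tendsto (fun k : ℕ => ((k : ℝ) + 1) * (g (w + a / (k + 1)) - g w)) atTop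
      (𝓝 (dirDeriv g w a)) := by
  have hint : w ∈ interior (Set.univ : Set ℝ) := by simp
  have hle := hg.leftDeriv_le_rightDeriv_of_mem_interior hint
  have h0 : Tendsto (fun k : ℕ => w + a / ((k : ℝ) + 1)) atTop (𝓝 w) := by
    have := (tendsto_one_div_add_atTop_nhds_zero_nat (𝕜 := ℝ)).const_mul a
    simpa [div_eq_mul_inv] using this.const_add w
  have key : ∀ d : ℝ, a ≠ 0 →
      Tendsto (fun k : ℕ => slope g w (w + a / ((k : ℝ) + 1))) atTop (𝓝 d) →
      Tendsto (fun k : ℕ => ((k : ℝ) + 1) * (g (w + a / (k + 1)) - g w)) atTop (𝓝 (d * a)) := by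
    intro d ha hd
    refine (hd.mul_const a).congr fun k => ?_
    have hk : (k : ℝ) + 1 ≠ 0 := by positivity
    rw [slope_def_field, add_sub_cancel_left]
    field_simp
  rcases lt_trichotomy a 0 with ha | ha | ha
  · have : dirDeriv g w a = derivWithin g (Set.Iio w) w * a := by
      unfold dirDeriv
      exact max_eq_right (mul_le_mul_of_nonpos_right hle ha.le)
    rw [this]
    refine key _ ha.ne ?_
    have h1 := (hasDerivWithinAt_iff_tendsto_slope' (by simp)).1
      (hg.hasDerivWithinAt_leftDeriv_of_mem_interior hint)
    refine h1.comp (tendsto_nhdsWithin_iff.2 ⟨h0, Eventually.of_forall fun k => ?_⟩)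
    have : a / ((k : ℝ) + 1) < 0 := div_neg_of_neg_of_pos ha (by positivity)
    simp only [Set.mem_Iio]; linarith
  · subst ha; simp [dirDeriv]
  · have : dirDeriv g w a = derivWithin g (Set.Ioi w) w * a := by
      unfold dirDeriv
      exact max_eq_left (mul_le_mul_of_nonneg_right hle ha.le)
    rw [this]
    refine key _ ha.ne' ?_
    have h1 := (hasDerivWithinAt_iff_tendsto_slope' (by simp)).1
      (hg.hasDerivWithinAt_rightDeriv_of_mem_interior hint)
    refine h1.comp (tendsto_nhdsWithin_iff.2 ⟨h0, Eventually.of_forall fun k => ?_⟩)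
    have : 0 < a / ((k : ℝ) + 1) := by positivity
    simp only [Set.mem_Ioi]; linarith

lemma dirDeriv_add_le (g : ℝ → ℝ) (w a b : ℝ) :
    dirDeriv g w (a + b) ≤ dirDeriv g w a + dirDeriv g w b := by
  simp only [dirDeriv, mul_add]
  exact max_add_add_le_max_add_max

lemma dirDeriv_mul (g : ℝ → ℝ) (w : ℝ) {t : ℝ} (ht : 0 ≤ t) (a : ℝ) :
    dirDeriv g w (t * a) = t * dirDeriv g w a := by
  simp only [dirDeriv, mul_max_of_nonneg _ _ ht]
  congr 1 <;> ring

@[simp] lemma dirDeriv_zero (g : ℝ → ℝ) (w : ℝ) : dirDeriv g w 0 = 0 := by simp [dirDeriv]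

lemma neg_dirDeriv_neg_one_le {g : ℝ → ℝ} (w : ℝ) :
    -dirDeriv g w (-1) ≤ dirDeriv g w 1 := by
  have := dirDeriv_add_le g w 1 (-1)
  simp at this; linarith

lemma dirDeriv_le {g : ℝ → ℝ} (hg : ConvexOn ℝ Set.univ g) (w v : ℝ) :
    dirDeriv g w (v - w) ≤ g v - g w := by
  have hint : w ∈ interior (Set.univ : Set ℝ) := by simp
  have hle := hg.leftDeriv_le_rightDeriv_of_mem_interior hint
  rcases lt_trichotomy v w with h | h | h
  · have h1 := hg.slope_le_leftDeriv_of_mem_interior (Set.mem_univ v) hint h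
    rw [slope_def_field, div_le_iff₀ (by linarith)] at h1
    exact max_le (by nlinarith) (by nlinarith)
  · simp [h]
  · have h1 := hg.rightDeriv_le_slope_of_mem_interior hint (Set.mem_univ v) h
    rw [slope_def_field, le_div_iff₀ (by linarith)] at h1
    exact max_le (by nlinarith) (by nlinarith)

/-- By positive homogeneity, the directions `1` and `-1` decide whether `s` is a subgradient. -/
lemma mul_le_dirDeriv {g : ℝ → ℝ} {w s : ℝ}
    (hs : s ∈ Set.Icc (-dirDeriv g w (-1)) (dirDeriv g w 1)) (a : ℝ) :
    s * a ≤ dirDeriv g w a := by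
  rcases le_total 0 a with h | h
  · have := dirDeriv_mul g w h 1
    rw [mul_one] at this; rw [this]; nlinarith [hs.2]
  · have := dirDeriv_mul g w (neg_nonneg.2 h) (-1)
    rw [mul_neg_one, neg_neg] at this; rw [this]; nlinarith [hs.1]

lemma abs_dirDeriv_le {g : ℝ → ℝ} (hg : ConvexOn ℝ Set.univ g) {w R c : ℝ} (hw : |w| < R)
    (hlip : ∀ v ∈ Set.Icc (-R) R, ∀ v' ∈ Set.Icc (-R) R, |g v - g v'| ≤ c * |v - v'|) (a : ℝ) :
    |dirDeriv g w a| ≤ c * |a| := by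
  have h0 : Tendsto (fun k : ℕ => w + a / ((k : ℝ) + 1)) atTop (𝓝 w) := by
    have := (tendsto_one_div_add_atTop_nhds_zero_nat (𝕜 := ℝ)).const_mul a
    simpa [div_eq_mul_inv] using this.const_add w
  refine le_of_tendsto (tendsto_dirDeriv hg w a).abs ?_
  -- Strictness of `|w| < R` keeps the perturbed point in the interval where the Lipschitz bound
  -- holds.
  have hev := h0.abs.eventually_lt_const hw
  filter_upwards [hev] with k hk
  have := hlip _ (abs_le.1 hk.le) _ (abs_le.1 hw.le)
  have hk1 : (0 : ℝ) < k + 1 := by positivity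
  rw [abs_mul, abs_of_pos hk1]
  calc ((k : ℝ) + 1) * |g (w + a / (k + 1)) - g w| ≤ (k + 1) * (c * |w + a / (k + 1) - w|) := by
        gcongr
    _ = c * |a| := by
        rw [add_sub_cancel_left, abs_div, abs_of_pos hk1]; field_simp

end Subgradient

/-! ### First-order variational inequality for the regularized risk -/

section FirstOrder

variable {Z : Type*} [MeasurableSpace Z]

/-- A finite convex function on the line is continuous, so `l` is a Carathéodory function and hence
jointly measurable. -/
lemma measurable_comp_of_convex {l : Z → ℝ → ℝ} (hconv : ∀ z, ConvexOn ℝ Set.univ (l z))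
    (hmeas : ∀ w, Measurable fun z => l z w) {u : Z → ℝ} (hu : Measurable u) :
    Measurable fun z => l z (u z) := by
  have h : Measurable (Function.uncurry fun (w : ℝ) z => l z w) :=
    measurable_uncurry_of_continuous_of_measurable
      (fun z => continuousOn_univ.1 ((hconv z).continuousOn isOpen_univ)) hmeas
  exact h.comp (hu.prodMk measurable_id)

lemma measurable_dirDeriv {l : Z → ℝ → ℝ} (hconv : ∀ z, ConvexOn ℝ Set.univ (l z))
    (hmeas : ∀ w, Measurable fun z => l z w) {u a : Z → ℝ} (hu : Measurable u)
    (ha : Measurable a) : Measurable fun z => dirDeriv (l z) (u z) (a z) := by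
  refine measurable_of_tendsto_metrizable
    (f := fun (k : ℕ) z => ((k : ℝ) + 1) * (l z (u z + a z / (k + 1)) - l z (u z))) (fun k => ?_)
    (tendsto_pi_nhds.2 fun z => tendsto_dirDeriv (hconv z) (u z) (a z))
  exact measurable_const.mul (((measurable_comp_of_convex hconv hmeas
    (hu.add (ha.div_const _)))).sub (measurable_comp_of_convex hconv hmeas hu))

variable {ρ : Measure Z} [IsProbabilityMeasure ρ]
  {H : Type*} [NormedAddCommGroup H] [InnerProductSpace ℝ H] {Φ : Z → H}

/-- Variational inequality for the minimizer of a regularized risk. -/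
lemma integral_dirDeriv_nonneg (hΦ : ∀ h : H, Measurable fun z => inner ℝ (Φ z) h) {κ : ℝ}
    (hκ : 0 < κ) (hΦκ : ∀ z, ‖Φ z‖ ≤ κ) {l : Z → ℝ → ℝ}
    (hconv : ∀ z, ConvexOn ℝ Set.univ (l z)) (hmeas : ∀ w, Measurable fun z => l z w)
    {f : H} {R c lam : ℝ} (hc : 0 ≤ c) (hR : κ * (‖f‖ + 1) ≤ R)
    (hlip : ∀ z, ∀ v ∈ Set.Icc (-R) R, ∀ v' ∈ Set.Icc (-R) R, |l z v - l z v'| ≤ c * |v - v'|)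
    (hint : Integrable (fun z => l z (inner ℝ (Φ z) f)) ρ)
    (hmin : ∀ h : H, ∫ z, l z (inner ℝ (Φ z) f) ∂ρ + lam * ‖f‖ ^ 2
      ≤ ∫ z, l z (inner ℝ (Φ z) h) ∂ρ + lam * ‖h‖ ^ 2) (h : H) :
    0 ≤ ∫ z, dirDeriv (l z) (inner ℝ (Φ z) f) (inner ℝ (Φ z) h) ∂ρ + 2 * lam * inner ℝ f h := by
  have hb : ∀ z (g : H), |inner ℝ (Φ z) g| ≤ κ * ‖g‖ := fun z g =>
    (abs_real_inner_le_norm _ _).trans (by gcongr; exact hΦκ z)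
  set F : ℕ → Z → ℝ := fun k z => ((k : ℝ) + 1) *
    (l z (inner ℝ (Φ z) f + inner ℝ (Φ z) h / (k + 1)) - l z (inner ℝ (Φ z) f)) with hF
  have hFm : ∀ k, Measurable (F k) := fun k => measurable_const.mul
    ((measurable_comp_of_convex hconv hmeas ((hΦ f).add ((hΦ h).div_const _))).sub
      (measurable_comp_of_convex hconv hmeas (hΦ f)))
  -- Once `k + 1 ≥ ‖h‖`, the perturbation is at most `κ` in absolute value; this is the room left by
  -- the `+ 1` in `κ * (‖f‖ + 1) ≤ R`.
  have hbound : ∀ᶠ k : ℕ in atTop, ∀ z, ‖F k z‖ ≤ c * (κ * ‖h‖) := by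
    filter_upwards [eventually_ge_atTop ⌈‖h‖⌉₊] with k hk z
    have hk' : ‖h‖ ≤ (k : ℝ) + 1 := by
      have := Nat.ceil_le.1 hk; linarith
    have hk1 : (0 : ℝ) < k + 1 := by positivity
    have e1 : |inner ℝ (Φ z) h / ((k : ℝ) + 1)| ≤ κ := by
      rw [abs_div, abs_of_pos hk1, div_le_iff₀ hk1]
      exact (hb z h).trans (by gcongr)
    have e0 := hb z f
    have e2 : |inner ℝ (Φ z) f + inner ℝ (Φ z) h / ((k : ℝ) + 1)| ≤ R :=
      (abs_add_le _ _).trans (by linarith)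
    have e3 := hlip z _ (abs_le.1 e2) _ (abs_le.1 (e0.trans (by linarith)))
    rw [Real.norm_eq_abs, hF]
    simp only
    rw [abs_mul, abs_of_pos hk1]
    calc _ ≤ ((k : ℝ) + 1) * (c * |inner ℝ (Φ z) f + inner ℝ (Φ z) h / (k + 1)
            - inner ℝ (Φ z) f|) := by gcongr
      _ = c * |inner ℝ (Φ z) h| := by
        rw [add_sub_cancel_left, abs_div, abs_of_pos hk1]; field_simp
      _ ≤ _ := by gcongr; exact hb z h
  have hlim : Tendsto (fun k => ∫ z, F k z ∂ρ) atTop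
      (𝓝 (∫ z, dirDeriv (l z) (inner ℝ (Φ z) f) (inner ℝ (Φ z) h) ∂ρ)) := by
    refine tendsto_integral_filter_of_dominated_convergence (fun _ => c * (κ * ‖h‖))
      (Eventually.of_forall fun k => (hFm k).aestronglyMeasurable) ?_ (integrable_const _)
      (Eventually.of_forall fun z => tendsto_dirDeriv (hconv z) _ _)
    filter_upwards [hbound] with k hk using Eventually.of_forall hk
  -- The last summand is the second-order part of the penalty along `f + h/(k+1)`; it vanishes in
  -- the limit.
  have hlim2 : Tendsto (fun k : ℕ => ∫ z, F k z ∂ρ + 2 * lam * inner ℝ f h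
      + lam * ‖h‖ ^ 2 * (1 / ((k : ℝ) + 1))) atTop
      (𝓝 (∫ z, dirDeriv (l z) (inner ℝ (Φ z) f) (inner ℝ (Φ z) h) ∂ρ
        + 2 * lam * inner ℝ f h)) := by
    simpa using (hlim.add_const (2 * lam * inner ℝ f h)).add
      ((tendsto_one_div_add_atTop_nhds_zero_nat (𝕜 := ℝ)).const_mul (lam * ‖h‖ ^ 2))
  refine ge_of_tendsto hlim2 ?_
  filter_upwards [hbound] with k hk
  have hk1 : (0 : ℝ) < k + 1 := by positivity
  have hFi : Integrable (F k) ρ :=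
    Integrable.of_bound (hFm k).aestronglyMeasurable _ (Eventually.of_forall hk)
  have h1 := hmin (f + (1 / ((k : ℝ) + 1)) • h)
  have h2 : ∫ z, l z (inner ℝ (Φ z) (f + (1 / ((k : ℝ) + 1)) • h)) ∂ρ
      = ∫ z, l z (inner ℝ (Φ z) f) ∂ρ + (1 / ((k : ℝ) + 1)) * ∫ z, F k z ∂ρ := by
    rw [← integral_const_mul, ← integral_add hint (hFi.const_mul _)]
    refine integral_congr_ae (Eventually.of_forall fun z => ?_)
    simp only [hF, inner_add_right, inner_smul_right]
    field_simp
    ring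
  have h3 : ‖f + (1 / ((k : ℝ) + 1)) • h‖ ^ 2
      = ‖f‖ ^ 2 + 2 * (1 / ((k : ℝ) + 1)) * inner ℝ f h + (1 / ((k : ℝ) + 1)) ^ 2 * ‖h‖ ^ 2 := by
    rw [norm_add_sq_real, inner_smul_right, norm_smul, mul_pow, Real.norm_eq_abs, sq_abs]; ring
  rw [h2, h3] at h1
  have h4 : 0 ≤ (1 / ((k : ℝ) + 1)) * (∫ z, F k z ∂ρ + 2 * lam * inner ℝ f h
      + lam * ‖h‖ ^ 2 * (1 / ((k : ℝ) + 1))) := by nlinarith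
  exact nonneg_of_mul_nonneg_right h4 (by positivity)

end FirstOrder

/-! ### Measurable subgradients from Hahn–Banach and Riesz -/

section SubgradientSelection

variable {Z : Type*} [MeasurableSpace Z] {ρ : Measure Z} [IsProbabilityMeasure ρ]

lemma integral_abs_le_norm_Lp_two (φ : Lp ℝ 2 ρ) : ∫ z, |φ z| ∂ρ ≤ ‖φ‖ := by
  have h1 : ∫ z, |φ z| ∂ρ = (eLpNorm φ 1 ρ).toReal := by
    rw [eLpNorm_one_eq_lintegral_enorm,
      ← integral_norm_eq_lintegral_enorm (Lp.aestronglyMeasurable φ)]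
    rfl
  rw [h1, Lp.norm_def]
  exact ENNReal.toReal_mono (Lp.eLpNorm_ne_top φ)
    (eLpNorm_le_eLpNorm_of_exponent_le (by norm_num) (Lp.aestronglyMeasurable φ))

variable {H : Type*} [NormedAddCommGroup H] [InnerProductSpace ℝ H] {Φ : Z → H}

/-- First-order condition for a regularized risk minimizer with a convex, possibly nonsmooth,
loss: some measurable selection `s` of subgradients satisfies `E[s Φ] = -2λ f` weakly. -/
theorem exists_subgradient_selection (hΦ : ∀ h : H, Measurable fun z => inner ℝ (Φ z) h) {κ : ℝ}
    (hκ : 0 < κ) (hΦκ : ∀ z, ‖Φ z‖ ≤ κ) {l : Z → ℝ → ℝ}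
    (hconv : ∀ z, ConvexOn ℝ Set.univ (l z)) (hmeas : ∀ w, Measurable fun z => l z w)
    {f : H} {R c lam : ℝ} (hc : 0 ≤ c) (hR : κ * (‖f‖ + 1) ≤ R)
    (hlip : ∀ z, ∀ v ∈ Set.Icc (-R) R, ∀ v' ∈ Set.Icc (-R) R, |l z v - l z v'| ≤ c * |v - v'|)
    (hint : Integrable (fun z => l z (inner ℝ (Φ z) f)) ρ)
    (hmin : ∀ h : H, ∫ z, l z (inner ℝ (Φ z) f) ∂ρ + lam * ‖f‖ ^ 2
      ≤ ∫ z, l z (inner ℝ (Φ z) h) ∂ρ + lam * ‖h‖ ^ 2) :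
    ∃ s : Z → ℝ, Measurable s ∧ (∀ z, |s z| ≤ c) ∧
      (∀ z w, l z (inner ℝ (Φ z) f) + s z * (w - inner ℝ (Φ z) f) ≤ l z w) ∧
      ∀ h : H, ∫ z, s z * inner ℝ (Φ z) h ∂ρ = -(2 * lam * inner ℝ f h) := by
  set u : Z → ℝ := fun z => inner ℝ (Φ z) f with hu
  have hb : ∀ z (g : H), |inner ℝ (Φ z) g| ≤ κ * ‖g‖ := fun z g =>
    (abs_real_inner_le_norm _ _).trans (by gcongr; exact hΦκ z)
  have huR : ∀ z, |u z| < R := fun z => (hb z f).trans_lt (by nlinarith)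
  set D : Z → ℝ → ℝ := fun z a => dirDeriv (l z) (u z) a with hD
  have hDle : ∀ z a, |D z a| ≤ c * |a| := fun z a => abs_dirDeriv_le (hconv z) (huR z) (hlip z) a
  have hDm : ∀ a : Z → ℝ, Measurable a → Measurable fun z => D z (a z) :=
    fun a ha => measurable_dirDeriv hconv hmeas (hΦ f) ha
  have hDi : ∀ a : Z → ℝ, Measurable a → Integrable a ρ → Integrable (fun z => D z (a z)) ρ := by
    intro a ha hai
    refine (hai.abs.const_mul c).mono' (hDm a ha).aestronglyMeasurable
      (Eventually.of_forall fun z => hDle z (a z))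
  have hvar : ∀ h : H, 0 ≤ ∫ z, D z (inner ℝ (Φ z) h) ∂ρ + 2 * lam * inner ℝ f h :=
    integral_dirDeriv_nonneg hΦ hκ hΦκ hconv hmeas hc hR hlip hint hmin
  have hΦi : ∀ h : H, Integrable (fun z => inner ℝ (Φ z) h) ρ := fun h =>
    Integrable.of_bound (hΦ h).aestronglyMeasurable _ (Eventually.of_forall fun z => hb z h)
  have hφm : ∀ φ : Lp ℝ 2 ρ, Measurable φ := fun φ => (Lp.stronglyMeasurable φ).measurable
  have hφi : ∀ φ : Lp ℝ 2 ρ, Integrable φ ρ := fun φ => (Lp.memLp φ).integrable (by norm_num)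
  set A : H × Lp ℝ 2 ρ → Z → ℝ := fun x z => inner ℝ (Φ z) x.1 + x.2 z with hA
  have hAm : ∀ x, Measurable (A x) := fun x => (hΦ x.1).add (hφm x.2)
  have hAi : ∀ x, Integrable (A x) ρ := fun x => (hΦi x.1).add (hφi x.2)
  -- `N` is sublinear and, by the variational inequality, nonnegative on `H × {0}`. The zero
  -- functional there therefore extends to some `G ≤ N`; its restriction to `L²` will be integration
  -- against the subgradient.
  set N : H × Lp ℝ 2 ρ → ℝ := fun x => ∫ z, D z (A x z) ∂ρ + 2 * lam * inner ℝ f x.1 with hN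
  let P : (H × Lp ℝ 2 ρ) →ₗ.[ℝ] ℝ := ⟨LinearMap.ker (LinearMap.snd ℝ H (Lp ℝ 2 ρ)), 0⟩
  obtain ⟨G, hG0, hGN⟩ : ∃ G : H × Lp ℝ 2 ρ →ₗ[ℝ] ℝ,
      (∀ x : P.domain, G x = P x) ∧ ∀ x, G x ≤ N x := by
    refine exists_extension_of_le_sublinear P N ?_ ?_ ?_
    · intro t ht x
      have : ∫ z, D z (A (t • x) z) ∂ρ = t * ∫ z, D z (A x z) ∂ρ := by
        rw [← integral_const_mul]
        refine integral_congr_ae ?_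
        filter_upwards [Lp.coeFn_smul t x.2] with z hz
        have : A (t • x) z = t * A x z := by
          simp only [hA, Prod.smul_fst, Prod.smul_snd, inner_smul_right, hz, Pi.smul_apply,
            smul_eq_mul]
          ring
        rw [this]
        exact dirDeriv_mul _ _ ht.le _
      simp only [hN, this, Prod.smul_fst, inner_smul_right]
      ring
    · intro x y
      have : ∫ z, D z (A (x + y) z) ∂ρ ≤ ∫ z, D z (A x z) ∂ρ + ∫ z, D z (A y z) ∂ρ := by
        rw [← integral_add (hDi _ (hAm x) (hAi x)) (hDi _ (hAm y) (hAi y))]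
        refine integral_mono_ae (hDi _ (hAm _) (hAi _))
          ((hDi _ (hAm x) (hAi x)).add (hDi _ (hAm y) (hAi y))) ?_
        filter_upwards [Lp.coeFn_add x.2 y.2] with z hz
        have : A (x + y) z = A x z + A y z := by
          simp only [hA, Prod.fst_add, Prod.snd_add, inner_add_right, hz, Pi.add_apply]
          ring
        rw [this]
        exact dirDeriv_add_le _ _ _ _
      simp only [hN, Prod.fst_add, inner_add_right]
      linarith
    · rintro ⟨x, hx⟩
      have hx2 : x.2 = 0 := hx
      have : ∫ z, D z (A x z) ∂ρ = ∫ z, D z (inner ℝ (Φ z) x.1) ∂ρ := by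
        refine integral_congr_ae ?_
        filter_upwards [Lp.coeFn_zero ℝ 2 ρ] with z hz
        simp only [hA, hx2, hz, Pi.zero_apply, add_zero]
      change (0 : ℝ) ≤ N x
      simp only [hN, this]
      exact hvar x.1
  set F : Lp ℝ 2 ρ →ₗ[ℝ] ℝ := G ∘ₗ LinearMap.inr ℝ H (Lp ℝ 2 ρ) with hF
  have hFle : ∀ φ : Lp ℝ 2 ρ, F φ ≤ ∫ z, D z (φ z) ∂ρ := by
    intro φ
    have := hGN (0, φ)
    simpa [hN, hA, hF] using this
  have hFle' : ∀ φ : Lp ℝ 2 ρ, F φ ≤ c * ‖φ‖ := by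
    intro φ
    refine (hFle φ).trans ?_
    calc ∫ z, D z (φ z) ∂ρ ≤ ∫ z, c * |φ z| ∂ρ :=
          integral_mono (hDi _ (hφm φ) (hφi φ)) ((hφi φ).abs.const_mul c)
            fun z => (le_abs_self _).trans (hDle z _)
      _ = c * ∫ z, |φ z| ∂ρ := integral_const_mul _ _
      _ ≤ c * ‖φ‖ := by gcongr; exact integral_abs_le_norm_Lp_two φ
  -- At `(h, -⟨Φ, h⟩)` the integral in `N` vanishes, so `G ≤ N` yields one inequality; replacing `h`
  -- by `-h` yields the other.
  have hFT : ∀ (h : H) (φ : Lp ℝ 2 ρ), (∀ᵐ z ∂ρ, φ z = inner ℝ (Φ z) h) →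
      F φ = -(2 * lam * inner ℝ f h) := by
    have hle : ∀ (h : H) (φ : Lp ℝ 2 ρ), (∀ᵐ z ∂ρ, φ z = inner ℝ (Φ z) h) →
        -(2 * lam * inner ℝ f h) ≤ F φ := by
      intro h φ hφ
      have h1 := hGN (h, -φ)
      have h2 : G (h, -φ) = - F φ := by
        have h3 : G (h, 0) = 0 := hG0 ⟨(h, 0), LinearMap.mem_ker.2 rfl⟩
        have h4 : (h, -φ) = (h, (0 : Lp ℝ 2 ρ)) - (0, φ) := by simp
        rw [h4, map_sub, h3]; simp [hF]
      have h5 : ∫ z, D z (A (h, -φ) z) ∂ρ = 0 := by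
        rw [← integral_zero Z ℝ (μ := ρ)]
        refine integral_congr_ae ?_
        filter_upwards [hφ, Lp.coeFn_neg φ] with z hz hz'
        simp only [hA, hD, hz', Pi.neg_apply, hz, add_neg_cancel, dirDeriv_zero]
      simp only [hN, h5, h2] at h1
      linarith
    intro h φ hφ
    refine le_antisymm ?_ (hle h φ hφ)
    have := hle (-h) (-φ) (by
      filter_upwards [hφ, Lp.coeFn_neg φ] with z hz hz'
      rw [hz', Pi.neg_apply, hz, inner_neg_right])
    simp at this
    linarith
  set Fc : Lp ℝ 2 ρ →L[ℝ] ℝ := F.mkContinuous c (fun φ => by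
    rw [Real.norm_eq_abs, abs_le]
    have h1 := hFle' φ
    have h2 := hFle' (-φ)
    rw [map_neg, norm_neg] at h2
    constructor <;> linarith) with hFc
  set s₀ : Lp ℝ 2 ρ := (InnerProductSpace.toDual ℝ (Lp ℝ 2 ρ)).symm Fc with hs₀
  have hs₀F : ∀ φ : Lp ℝ 2 ρ, ∫ z, s₀ z * φ z ∂ρ = F φ := by
    intro φ
    have h1 : inner ℝ s₀ φ = F φ := by
      rw [hs₀, InnerProductSpace.toDual_symm_apply]; rfl
    rw [← h1, L2.inner_def]
    refine integral_congr_ae (Eventually.of_forall fun z => ?_)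
    simp [mul_comm]
  -- Testing on indicators localizes the integral bound to an almost everywhere bound.
  have hset : ∀ (b : ℝ) (S : Set Z), MeasurableSet S →
      ∫ z in S, s₀ z * b ∂ρ ≤ ∫ z in S, D z b ∂ρ := by
    intro b S hS
    have h1 := hFle (indicatorConstLp 2 hS (measure_ne_top ρ S) b)
    rw [← hs₀F] at h1
    rw [← integral_indicator hS, ← integral_indicator hS]
    refine le_trans (le_of_eq ?_) (h1.trans (le_of_eq ?_))
    · refine integral_congr_ae ?_
      filter_upwards [indicatorConstLp_coeFn (p := 2) (hs := hS) (hμs := measure_ne_top ρ S)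
        (c := b)] with z hz
      rw [hz]
      by_cases hzS : z ∈ S <;> simp [hzS]
    · refine integral_congr_ae ?_
      filter_upwards [indicatorConstLp_coeFn (p := 2) (hs := hS) (hμs := measure_ne_top ρ S)
        (c := b)] with z hz
      rw [hz]
      by_cases hzS : z ∈ S <;> simp [hzS, hD]
  have hae : ∀ b : ℝ, ∀ᵐ z ∂ρ, s₀ z * b ≤ D z b := fun b =>
    ae_le_of_forall_setIntegral_le ((hφi s₀).mul_const b)
      (hDi (fun _ => b) measurable_const (integrable_const b)) fun S hS _ => hset b S hS
  -- Clipping changes `s₀` only on a null set and makes the subgradient inequality hold at every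
  -- point, as needed for evaluation at arbitrary samples.
  set s : Z → ℝ := fun z => max (-D z (-1)) (min (D z 1) (s₀ z)) with hs
  have hsIcc : ∀ z, s z ∈ Set.Icc (-D z (-1)) (D z 1) := fun z =>
    ⟨le_max_left _ _, max_le (neg_dirDeriv_neg_one_le _) (min_le_left _ _)⟩
  have hss₀ : s =ᵐ[ρ] s₀ := by
    filter_upwards [hae 1, hae (-1)] with z h1 h2
    simp only [hs]
    rw [min_eq_right (by linarith), max_eq_right (by linarith)]
  refine ⟨s, ?_, fun z => ?_, fun z w => ?_, fun h => ?_⟩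
  · exact (hDm _ measurable_const).neg.max ((hDm _ measurable_const).min (hφm s₀))
  · have h1 := hDle z 1
    have h2 := hDle z (-1)
    simp only [abs_neg, abs_one, mul_one] at h1 h2
    exact abs_le.2 ⟨by linarith [(hsIcc z).1, (abs_le.1 h2).2],
      by linarith [(hsIcc z).2, (abs_le.1 h1).2]⟩
  · have h1 := mul_le_dirDeriv (hsIcc z) (w - u z)
    have h2 := dirDeriv_le (hconv z) (u z) w
    linarith
  · have hmem : MemLp (fun z => inner ℝ (Φ z) h) 2 ρ :=
      MemLp.of_bound (hΦ h).aestronglyMeasurable _ (Eventually.of_forall fun z => hb z h)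
    rw [← hFT h hmem.toLp hmem.coeFn_toLp, ← hs₀F]
    refine integral_congr_ae ?_
    filter_upwards [hss₀, hmem.coeFn_toLp] with z h1 h2
    rw [h1, h2]

end SubgradientSelection

/-! ### Concentration of the estimator around the regularized minimizer -/

section Concentration

variable {Z : Type*} [MeasurableSpace Z] {ρ : Measure Z} [IsProbabilityMeasure ρ]
  {H : Type*} [NormedAddCommGroup H] [InnerProductSpace ℝ H]

lemma map_pair_pi {n : ℕ} {i j : Fin n} (hij : i ≠ j) :
    (Measure.pi fun _ : Fin n => ρ).map (fun z => (z i, z j)) = ρ.prod ρ := by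
  have h1 := (ProbabilityTheory.iIndepFun_pi (μ := fun _ : Fin n => ρ)
    (X := fun _ => (id : Z → Z)) fun _ => aemeasurable_id).indepFun hij
  have h2 := (ProbabilityTheory.indepFun_iff_map_prod_eq_prod_map_map
    (measurable_pi_apply i).aemeasurable (measurable_pi_apply j).aemeasurable).1 h1
  have h3 : ∀ k : Fin n, (Measure.pi fun _ : Fin n => ρ).map (fun z => z k) = ρ := fun k =>
    (measurePreserving_eval (fun _ : Fin n => ρ) k).map_eq
  simpa [h3] using h2

/-- Chebyshev's inequality for a sum of i.i.d. centred bounded elements of an inner product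
space. -/
theorem measure_le_norm_sum_le {G : Z → H}
    (hG : Measurable fun x : Z × Z => (inner ℝ (G x.1) (G x.2) : ℝ)) {B : ℝ}
    (hB : ∀ z, ‖G z‖ ≤ B) (h0 : ∀ g : H, ∫ z, inner ℝ (G z) g ∂ρ = 0) (n : ℕ) {t : ℝ}
    (ht : 0 < t) :
    (Measure.pi fun _ : Fin n => ρ).real {z | t ≤ ‖∑ i, G (z i)‖} ≤ n * B ^ 2 / t ^ 2 := by
  set μ := Measure.pi fun _ : Fin n => ρ
  have hB2 : ∀ z z', |inner ℝ (G z) (G z')| ≤ B ^ 2 := fun z z' =>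
    (abs_real_inner_le_norm _ _).trans (by
      rw [sq]; exact mul_le_mul (hB z) (hB z') (norm_nonneg _) ((norm_nonneg _).trans (hB z)))
  -- Only scalar products of values of `G` are integrated, so measurability of `G` as an `H`-valued
  -- map is not needed.
  have hexp : ∀ z : Fin n → Z, ‖∑ i, G (z i)‖ ^ 2
      = ∑ i, ∑ j, inner ℝ (G (z i)) (G (z j)) := fun z => by
    rw [← real_inner_self_eq_norm_sq, sum_inner]
    simp_rw [inner_sum]
  have hm : ∀ i j : Fin n, Measurable fun z : Fin n → Z => (inner ℝ (G (z i)) (G (z j)) : ℝ) :=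
    fun i j => hG.comp (f := fun z : Fin n → Z => (z i, z j)) 
      ((measurable_pi_apply i).prodMk (measurable_pi_apply j))
  have hi : ∀ i j : Fin n, Integrable (fun z : Fin n → Z => (inner ℝ (G (z i)) (G (z j)) : ℝ)) μ :=
    fun i j => Integrable.of_bound (hm i j).aestronglyMeasurable (B ^ 2)
      (Eventually.of_forall fun z => hB2 _ _)
  have hle : ∀ i j : Fin n, ∫ z, inner ℝ (G (z i)) (G (z j)) ∂μ ≤ if i = j then B ^ 2 else 0 := by
    intro i j
    split_ifs with hij
    · calc _ ≤ ∫ _, B ^ 2 ∂μ :=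
          integral_mono (hi i j) (integrable_const _) fun z => (le_abs_self _).trans (hB2 _ _)
        _ = B ^ 2 := by simp
    -- Off the diagonal the pair has law `ρ.prod ρ`, and integrating one variable out gives zero by
    -- `h0`.
    · have h1 : ∫ z, inner ℝ (G (z i)) (G (z j)) ∂μ
          = ∫ x, inner ℝ (G x.1) (G x.2) ∂(ρ.prod ρ) := by
        rw [← map_pair_pi hij, integral_map (by fun_prop) hG.aestronglyMeasurable]
      have h2 : Integrable (fun x : Z × Z => (inner ℝ (G x.1) (G x.2) : ℝ)) (ρ.prod ρ) :=
        Integrable.of_bound hG.aestronglyMeasurable (B ^ 2)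
          (Eventually.of_forall fun z => hB2 _ _)
      rw [h1, integral_prod_symm _ h2]
      simp [h0]
  have hint : Integrable (fun z : Fin n → Z => ‖∑ i, G (z i)‖ ^ 2) μ := by
    simp_rw [hexp]
    exact integrable_finsetSum _ fun i _ => integrable_finsetSum _ fun j _ => hi i j
  have hval : ∫ z, ‖∑ i, G (z i)‖ ^ 2 ∂μ ≤ n * B ^ 2 := by
    simp_rw [hexp]
    rw [integral_finsetSum _ fun i _ => integrable_finsetSum _ fun j _ => hi i j]
    simp_rw [integral_finsetSum _ fun j _ => hi _ j]
    calc _ ≤ ∑ i : Fin n, ∑ j : Fin n, (if i = j then B ^ 2 else 0) :=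
          Finset.sum_le_sum fun i _ => Finset.sum_le_sum fun j _ => hle i j
      _ = n * B ^ 2 := by simp
  have hmk := mul_meas_ge_le_integral_of_nonneg (μ := μ)
    (Eventually.of_forall fun z => sq_nonneg ‖∑ i, G (z i)‖) hint (t ^ 2)
  have hset : {z : Fin n → Z | t ≤ ‖∑ i, G (z i)‖}
      = {z : Fin n → Z | t ^ 2 ≤ ‖∑ i, G (z i)‖ ^ 2} := by
    ext z
    exact (pow_le_pow_iff_left₀ ht.le (norm_nonneg _) two_ne_zero).symm
  rw [hset, le_div_iff₀ (by positivity), mul_comm]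
  exact hmk.trans hval

/-- Deterministic stability of the empirical regularized minimizer around a point at which
subgradients of the loss are known. -/
lemma norm_sub_le_of_isMin {Z : Type*} {Φ : Z → H} {l : Z → ℝ → ℝ} {f fh : H} {s : Z → ℝ} {lam : ℝ}
    (hs : ∀ z w, l z (inner ℝ (Φ z) f) + s z * (w - inner ℝ (Φ z) f) ≤ l z w)
    {n : ℕ} (hn : 1 ≤ n) (z : Fin n → Z)
    (hmin : (1 / (n : ℝ)) * ∑ i, l (z i) (inner ℝ (Φ (z i)) fh) + lam * ‖fh‖ ^ 2
      ≤ (1 / (n : ℝ)) * ∑ i, l (z i) (inner ℝ (Φ (z i)) f) + lam * ‖f‖ ^ 2) :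
    n * lam * ‖fh - f‖ ≤ ‖∑ i, (s (z i) • Φ (z i) + (2 * lam) • f)‖ := by
  have hn' : (0 : ℝ) < n := by exact_mod_cast hn
  set d := fh - f with hd
  have hfh : fh = f + d := by rw [hd]; abel
  set T := ∑ i, (s (z i) • Φ (z i) + (2 * lam) • f) with hT
  have h1 : ∑ i, l (z i) (inner ℝ (Φ (z i)) f) + ∑ i, s (z i) * inner ℝ (Φ (z i)) d
      ≤ ∑ i, l (z i) (inner ℝ (Φ (z i)) fh) := by
    rw [← Finset.sum_add_distrib]
    refine Finset.sum_le_sum fun i _ => ?_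
    have := hs (z i) (inner ℝ (Φ (z i)) fh)
    rwa [← inner_sub_right] at this
  have h2 : inner ℝ T d = ∑ i, s (z i) * inner ℝ (Φ (z i)) d + n * (2 * lam * inner ℝ f d) := by
    rw [hT, sum_inner]
    simp [inner_add_left, real_inner_smul_left, Finset.sum_add_distrib]
  have h3 : ‖fh‖ ^ 2 = ‖f‖ ^ 2 + 2 * inner ℝ f d + ‖d‖ ^ 2 := by
    rw [hfh, norm_add_sq_real]
  have h4 : ∑ i, l (z i) (inner ℝ (Φ (z i)) fh) + n * (lam * ‖fh‖ ^ 2)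
      ≤ ∑ i, l (z i) (inner ℝ (Φ (z i)) f) + n * (lam * ‖f‖ ^ 2) := by
    have := mul_le_mul_of_nonneg_left hmin hn'.le
    have e : ∀ a b : ℝ, (n : ℝ) * (1 / n * a + b) = a + n * b := fun a b => by field_simp
    rwa [e, e] at this
  -- The linear part of the penalty is absorbed in `T`; its quadratic part remains on the left.
  have h5 : n * lam * ‖d‖ ^ 2 ≤ -inner ℝ T d := by
    rw [h2]; rw [h3] at h4; linarith
  have h6 : -inner ℝ T d ≤ ‖T‖ * ‖d‖ := by
    have := abs_real_inner_le_norm T d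
    linarith [neg_abs_le (inner ℝ T d)]
  rcases (norm_nonneg d).eq_or_lt with h | h
  · rw [← h, mul_zero]; exact norm_nonneg _
  · have : n * lam * ‖d‖ * ‖d‖ ≤ ‖T‖ * ‖d‖ := by nlinarith
    exact le_of_mul_le_mul_right this h

/-- The regularized M-estimator concentrates around the population regularized minimizer. -/
theorem measure_lt_norm_sub_le {Φ : Z → H} (hΦ : ∀ h : H, Measurable fun z => inner ℝ (Φ z) h)
    (hΦ₂ : Measurable fun x : Z × Z => (inner ℝ (Φ x.1) (Φ x.2) : ℝ)) {κ : ℝ}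
    (hκ : 0 < κ) (hΦκ : ∀ z, ‖Φ z‖ ≤ κ) {l : Z → ℝ → ℝ}
    (hconv : ∀ z, ConvexOn ℝ Set.univ (l z)) (hmeas : ∀ w, Measurable fun z => l z w)
    {f : H} {M c lam : ℝ} (hc : 0 ≤ c) (hM : ‖f‖ ≤ M) (hlam : 0 < lam) (hlam1 : lam ≤ 1)
    (hlip : ∀ z, ∀ v ∈ Set.Icc (-(κ * (M + 1))) (κ * (M + 1)),
      ∀ v' ∈ Set.Icc (-(κ * (M + 1))) (κ * (M + 1)), |l z v - l z v'| ≤ c * |v - v'|)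
    (hint : Integrable (fun z => l z (inner ℝ (Φ z) f)) ρ)
    (hmin : ∀ h : H, ∫ z, l z (inner ℝ (Φ z) f) ∂ρ + lam * ‖f‖ ^ 2
      ≤ ∫ z, l z (inner ℝ (Φ z) h) ∂ρ + lam * ‖h‖ ^ 2)
    {n : ℕ} (hn : 1 ≤ n) {fh : (Fin n → Z) → H}
    (hfh : ∀ z, (1 / (n : ℝ)) * ∑ i, l (z i) (inner ℝ (Φ (z i)) (fh z)) + lam * ‖fh z‖ ^ 2
      ≤ (1 / (n : ℝ)) * ∑ i, l (z i) (inner ℝ (Φ (z i)) f) + lam * ‖f‖ ^ 2)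
    {r : ℝ} (hr : 0 < r) :
    (Measure.pi fun _ : Fin n => ρ).real {z | r < ‖fh z - f‖}
      ≤ (c * κ + 2 * M) ^ 2 / (n * lam ^ 2 * r ^ 2) := by
  have hn' : (0 : ℝ) < n := by exact_mod_cast hn
  obtain ⟨s, hsm, hsc, hsub, hfoc⟩ := exists_subgradient_selection hΦ hκ hΦκ hconv hmeas hc
    (by gcongr : κ * (‖f‖ + 1) ≤ κ * (M + 1)) hlip hint hmin
  -- The first-order condition says exactly that this is centred against every `g`.
  set G : Z → H := fun z => s z • Φ z + (2 * lam) • f with hG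
  have hGm : Measurable fun x : Z × Z => (inner ℝ (G x.1) (G x.2) : ℝ) := by
    have e : (fun x : Z × Z => (inner ℝ (G x.1) (G x.2) : ℝ)) = fun x =>
        s x.1 * (s x.2 * inner ℝ (Φ x.1) (Φ x.2)) + s x.1 * (2 * lam * inner ℝ (Φ x.1) f)
        + (2 * lam * (s x.2 * inner ℝ (Φ x.2) f) + 2 * lam * (2 * lam * inner ℝ f f)) := by
      ext x
      simp only [hG, inner_add_left, inner_add_right, real_inner_smul_left, real_inner_smul_right,
        real_inner_comm (Φ x.2) f]
      rw [real_inner_comm f (Φ x.2)]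
      ring
    rw [e]
    have m1 : Measurable fun x : Z × Z => s x.1 := hsm.comp measurable_fst
    have m2 : Measurable fun x : Z × Z => s x.2 := hsm.comp measurable_snd
    have m3 : Measurable fun x : Z × Z => (inner ℝ (Φ x.1) f : ℝ) :=
      (hΦ f).comp measurable_fst
    have m4 : Measurable fun x : Z × Z => (inner ℝ (Φ x.2) f : ℝ) :=
      (hΦ f).comp measurable_snd
    exact ((m1.mul (m2.mul hΦ₂)).add (m1.mul (m3.const_mul _))).add
      (((m2.mul m4).const_mul _).add measurable_const)
  have hGB : ∀ z, ‖G z‖ ≤ c * κ + 2 * M := by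
    intro z
    refine (norm_add_le _ _).trans ?_
    rw [norm_smul, norm_smul, Real.norm_eq_abs, Real.norm_eq_abs,
      abs_of_pos (by positivity : 0 < 2 * lam)]
    refine add_le_add (mul_le_mul (hsc z) (hΦκ z) (norm_nonneg _) hc) ?_
    exact mul_le_mul (by linarith) hM (norm_nonneg _) (by norm_num)
  have hG0 : ∀ g : H, ∫ z, inner ℝ (G z) g ∂ρ = 0 := by
    intro g
    simp only [hG, inner_add_left, real_inner_smul_left]
    have hi : Integrable (fun z => s z * inner ℝ (Φ z) g) ρ :=
      Integrable.of_bound (hsm.mul (hΦ g)).aestronglyMeasurable (c * (κ * ‖g‖))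
        (Eventually.of_forall fun z => by
          rw [Real.norm_eq_abs, abs_mul]
          exact mul_le_mul (hsc z) ((abs_real_inner_le_norm _ _).trans
            (by gcongr; exact hΦκ z)) (abs_nonneg _) hc)
    rw [integral_add hi (integrable_const _), hfoc]
    simp
  have ht : 0 < n * lam * r := by positivity
  calc _ ≤ (Measure.pi fun _ : Fin n => ρ).real {z | n * lam * r ≤ ‖∑ i, G (z i)‖} := by
        refine measureReal_mono fun z hz => ?_
        have h1 := norm_sub_le_of_isMin hsub hn z (hfh z)
        have h2 : r < ‖fh z - f‖ := hz
        have h3 : n * lam * r ≤ n * lam * ‖fh z - f‖ := by gcongr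
        exact h3.trans h1
    _ ≤ n * (c * κ + 2 * M) ^ 2 / (n * lam * r) ^ 2 :=
        measure_le_norm_sum_le hGm hGB hG0 n ht
    _ = _ := by field_simp

end Concentration

/-! ### Kernel sections and the reproducing property -/

section Reproducing

variable {X : Type*} {H : Type*} [NormedAddCommGroup H] [InnerProductSpace ℝ H]
  [CompleteSpace H] [RKHS ℝ H X ℝ]

lemma inner_kerSection (x : X) (f : H) : inner ℝ (kerSection H x) f = f x := by
  simp [kerSection]

lemma kerSection_symm (x y : X) : kerSection H x y = kerSection H y x := by
  rw [← inner_kerSection (H := H) y, ← inner_kerSection (H := H) x, real_inner_comm]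

lemma kerSection_span_dense :
    (Submodule.span ℝ (Set.range fun x : X => kerSection H x)).topologicalClosure = ⊤ := by
  rw [eq_top_iff, ← RKHS.kerFun_dense (𝕜 := ℝ) (X := X) (V := ℝ) H]
  refine Submodule.topologicalClosure_mono (Submodule.span_le.2 ?_)
  rintro _ ⟨x, v, rfl⟩
  have : RKHS.kerFun H x v = v • kerSection H x := by
    rw [kerSection, ← map_smul]; simp
  rw [this]
  exact Submodule.smul_mem _ _ (Submodule.subset_span ⟨x, rfl⟩)

end Reproducing

/-! ### Derivative reproducing property -/

section Gradient

variable {p : ℕ} {𝒳 : Set (EuclideanSpace ℝ (Fin p))}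

lemma extendZero_apply (f : 𝒳 → ℝ) (x : 𝒳) : extendZero f x = f x :=
  Subtype.val_injective.extend_apply _ _ _

lemma extendZero_of_notMem (f : 𝒳 → ℝ) {x : EuclideanSpace ℝ (Fin p)} (hx : x ∉ 𝒳) :
    extendZero f x = 0 :=
  Function.extend_apply' _ _ _ (by rintro ⟨y, rfl⟩; exact hx y.2)

lemma extendZero_add (f g : 𝒳 → ℝ) :
    extendZero (fun x => f x + g x) = fun x => extendZero f x + extendZero g x := by
  ext x
  by_cases hx : x ∈ 𝒳
  · lift x to 𝒳 using hx
    simp only [extendZero_apply]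
  · simp [extendZero_of_notMem _ hx]

lemma extendZero_const_mul (c : ℝ) (f : 𝒳 → ℝ) :
    extendZero (fun x => c * f x) = fun x => c * extendZero f x := by
  ext x
  by_cases hx : x ∈ 𝒳
  · lift x to 𝒳 using hx
    simp only [extendZero_apply]
  · simp [extendZero_of_notMem _ hx]

/-- Every point of `𝒳` is a limit of interior points, where the line derivative equals `g`;
continuity of `g` then identifies the limit taken by `extendFrom`. -/
lemma partialDeriv_eq (h𝒳' : 𝒳 ⊆ closure (interior 𝒳)) {f g : 𝒳 → ℝ} (hg : Continuous g)
    {l : Fin p} (hfg : ∀ x : 𝒳, (x : EuclideanSpace ℝ (Fin p)) ∈ interior 𝒳 →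
      HasLineDerivAt ℝ (extendZero f) (g x) (x : EuclideanSpace ℝ (Fin p))
        (EuclideanSpace.single l 1)) (x : 𝒳) :
    partialDeriv l f x = g x := by
  refine extendFrom_eq (h𝒳' x.2) ?_
  have h1 : ContinuousOn (extendZero g) 𝒳 := by
    rw [continuousOn_iff_continuous_domRestrict]
    convert hg using 1
    ext y
    exact extendZero_apply g y
  have h2 := (h1 x x.2).mono_left (nhdsWithin_mono _ (interior_subset (s := 𝒳)))
  rw [extendZero_apply] at h2
  refine h2.congr' ?_
  filter_upwards [self_mem_nhdsWithin] with z hz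
  have := (hfg ⟨z, interior_subset hz⟩ hz).lineDeriv
  rw [this]
  exact extendZero_apply g ⟨z, interior_subset hz⟩

variable {H : Type*} [NormedAddCommGroup H] [InnerProductSpace ℝ H] [CompleteSpace H]
  [RKHS ℝ H 𝒳 ℝ]

/-- `f` is continuous with continuous partial derivatives represented by inner products with the
elements `k l x`. -/
def HasRepresentedGradient (k : Fin p → 𝒳 → H) (f : H) : Prop :=
  Continuous (fun x : 𝒳 => f x) ∧ ∀ l : Fin p, Continuous (fun x : 𝒳 => (inner ℝ (k l x) f : ℝ)) ∧
    ∀ x : 𝒳, (x : EuclideanSpace ℝ (Fin p)) ∈ interior 𝒳 →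
      HasLineDerivAt ℝ (extendZero fun x : 𝒳 => f x) (inner ℝ (k l x) f)
        (x : EuclideanSpace ℝ (Fin p)) (EuclideanSpace.single l 1)

/-- The functions with represented gradient form a subspace. -/
def representedGradientSubmodule (k : Fin p → 𝒳 → H) : Submodule ℝ H where
  carrier := {f | HasRepresentedGradient k f}
  add_mem' := by
    rintro f g ⟨hf, hf'⟩ ⟨hg, hg'⟩
    refine ⟨by simp only [RKHS.coe_add, Pi.add_apply]; exact hf.add hg, fun l => ⟨?_, fun x hx => ?_⟩⟩
    · simp only [inner_add_right]
      exact (hf' l).1.add (hg' l).1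
    · have := ((hf' l).2 x hx).add ((hg' l).2 x hx)
      simp only [RKHS.coe_add, Pi.add_apply, extendZero_add, inner_add_right]
      exact this
  zero_mem' := by
    refine ⟨by simpa using continuous_const, fun l => ⟨by simpa using continuous_const,
      fun x hx => ?_⟩⟩
    have : (extendZero fun x : 𝒳 => (0 : H) x) = fun _ => 0 := by
      simpa using extendZero_const_mul 0 (fun _ : 𝒳 => (0 : ℝ))
    rw [this, inner_zero_right]
    exact hasDerivAt_const _ _
  smul_mem' := by
    rintro c f ⟨hf, hf'⟩
    refine ⟨by simpa using hf.const_mul c, fun l => ⟨?_, fun x hx => ?_⟩⟩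
    · simpa only [inner_smul_right] using (hf' l).1.const_mul c
    · have := HasDerivAt.const_mul c ((hf' l).2 x hx)
      simp only [RKHS.coe_smul, Pi.smul_apply, smul_eq_mul, extendZero_const_mul,
        inner_smul_right]
      exact this

/-- Cauchy–Schwarz over a bounded family of representers. It serves both for values and for partial
derivatives. -/
lemma tendstoUniformly_inner {H : Type*} [NormedAddCommGroup H] [InnerProductSpace ℝ H]
    {ι : Type*} {k : ι → H} {κ : ℝ} (hk : ∀ i, ‖k i‖ ≤ κ)
    {F : ℕ → H} {f : H} (hF : Tendsto F atTop (𝓝 f)) :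
    TendstoUniformly (fun n i => (inner ℝ (k i) (F n) : ℝ)) (fun i => inner ℝ (k i) f) atTop := by
  rw [Metric.tendstoUniformly_iff]
  intro ε hε
  have h1 : Tendsto (fun n => κ * ‖F n - f‖) atTop (𝓝 0) := by
    simpa using (tendsto_iff_norm_sub_tendsto_zero.1 hF).const_mul κ
  filter_upwards [h1.eventually_lt_const hε] with n hn i
  rw [dist_comm, Real.dist_eq, ← inner_sub_right]
  refine lt_of_le_of_lt ((abs_real_inner_le_norm _ _).trans ?_) hn
  gcongr
  exact hk i

/-- Norm convergence makes values and represented derivatives converge uniformly, and a uniform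
limit of derivatives along a coordinate line is the derivative of the limit. -/
lemma isClosed_representedGradientSubmodule {k : Fin p → 𝒳 → H} {κ₁ κ₂ : ℝ}
    (hκ₁ : ∀ x : 𝒳, ‖kerSection H x‖ ≤ κ₁) (hk : ∀ l x, ‖k l x‖ ≤ κ₂) :
    IsClosed (representedGradientSubmodule k : Set H) := by
  refine isClosed_of_closure_subset fun f hf => ?_
  obtain ⟨F, hFmem, hF⟩ := mem_closure_iff_seq_limit.1 hf
  have hFmem' : ∀ n, HasRepresentedGradient k (F n) := hFmem
  have huni := tendstoUniformly_inner hκ₁ hF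
  simp only [inner_kerSection] at huni
  refine ⟨huni.continuous (Frequently.of_forall fun n => (hFmem' n).1), fun l => ?_⟩
  have huni' := tendstoUniformly_inner (hk l) hF
  refine ⟨huni'.continuous (Frequently.of_forall fun n => ((hFmem' n).2 l).1), fun x hx => ?_⟩
  set e : EuclideanSpace ℝ (Fin p) := EuclideanSpace.single l 1
  set line : ℝ → EuclideanSpace ℝ (Fin p) := fun t => x + t • e with hline
  have hlc : Continuous line := by fun_prop
  have hopen : IsOpen (line ⁻¹' interior 𝒳) := isOpen_interior.preimage hlc
  have h0 : (0 : ℝ) ∈ line ⁻¹' interior 𝒳 := by simpa [hline] using hx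
  have h := hasDerivAt_of_tendstoUniformlyOn (l := atTop)
    (f := fun n t => extendZero (fun x : 𝒳 => F n x) (line t))
    (f' := fun n t => extendZero (fun x : 𝒳 => (inner ℝ (k l x) (F n) : ℝ)) (line t))
    (g := fun t => extendZero (fun x : 𝒳 => f x) (line t))
    (g' := fun t => extendZero (fun x : 𝒳 => (inner ℝ (k l x) f : ℝ)) (line t))
    hopen ?_ ?_ ?_ h0
  · have e0 : line 0 = x := by simp [hline]
    simp only [e0, extendZero_apply] at h
    exact h
  · rw [Metric.tendstoUniformlyOn_iff]
    intro ε hε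
    filter_upwards [Metric.tendstoUniformly_iff.1 huni' ε hε] with n hn t ht
    have hm : line t ∈ 𝒳 := interior_subset ht
    have e1 : ∀ G : 𝒳 → ℝ, extendZero G (line t) = G ⟨line t, hm⟩ :=
      fun G => extendZero_apply G ⟨line t, hm⟩
    simp only [e1]
    exact hn _
  · refine Eventually.of_forall fun n t ht => ?_
    have hm : line t ∈ 𝒳 := interior_subset ht
    have e1 : ∀ G : 𝒳 → ℝ, extendZero G (line t) = G ⟨line t, hm⟩ :=
      fun G => extendZero_apply G ⟨line t, hm⟩
    have h1 : HasDerivAt (fun s : ℝ => extendZero (fun x : 𝒳 => F n x) (line t + s • e))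
      (inner ℝ (k l ⟨line t, hm⟩) (F n)) 0 := ((hFmem' n).2 l).2 ⟨line t, hm⟩ ht
    have h2 := HasDerivAt.comp_sub_const t t (by rwa [sub_self])
      (f := fun s : ℝ => extendZero (fun x : 𝒳 => F n x) (line t + s • e))
    rw [e1]
    convert h2 using 3 with s
    simp only [hline]
    module
  · intro t ht
    have hm : line t ∈ 𝒳 := interior_subset ht
    have e1 : ∀ G : 𝒳 → ℝ, extendZero G (line t) = G ⟨line t, hm⟩ :=
      fun G => extendZero_apply G ⟨line t, hm⟩
    simp only [e1]
    exact huni.tendsto_at _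

/-- Elements of the RKHS are continuous, and the partial derivatives are given by the derivative
reproducing property. -/
theorem exists_gradient_representer (h𝒳' : 𝒳 ⊆ closure (interior 𝒳))
    (hK : ∀ y : 𝒳, HasContinuousPartials (fun x : 𝒳 => kerSection H x y)) {κ₁ κ₂ : ℝ}
    (hbdd : BoundedKernel 𝒳 H κ₁ κ₂) :
    ∃ k : Fin p → 𝒳 → H, (∀ l x, ‖k l x‖ ≤ κ₂) ∧ ∀ f : H, Continuous (fun x : 𝒳 => f x) ∧
      ∀ l, Continuous (partialDeriv l fun x : 𝒳 => f x) ∧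
        ∀ x, partialDeriv l (fun x : 𝒳 => f x) x = inner ℝ (k l x) f := by
  obtain ⟨hκ₁, hk⟩ := hbdd
  choose k hk1 hk2 using hk
  have hall : ∀ f : H, HasRepresentedGradient k f := by
    -- It suffices to treat kernel sections: their span is dense and the subspace is closed.
    have hle : Submodule.span ℝ (Set.range fun x : 𝒳 => kerSection H x)
        ≤ representedGradientSubmodule k := by
      refine Submodule.span_le.2 ?_
      rintro _ ⟨y, rfl⟩
      have e : (fun x : 𝒳 => kerSection H y x) = fun x => kerSection H x y :=
        funext fun x => kerSection_symm y x
      have hKy := hK y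
      refine ⟨by rw [e]; exact hKy.1, fun l => ?_⟩
      obtain ⟨g, hg, hgd⟩ := hKy.2 l
      have e2 : (fun x : 𝒳 => (inner ℝ (k l x) (kerSection H y) : ℝ)) = g := by
        ext x
        rw [real_inner_comm, inner_kerSection, hk1, partialDeriv_eq h𝒳' hg hgd]
      refine ⟨by rw [e2]; exact hg, fun x hx => ?_⟩
      rw [e, congrFun e2 x]
      exact hgd x hx
    have htop := Submodule.topologicalClosure_minimal _ hle
      (isClosed_representedGradientSubmodule hκ₁ hk2)
    rw [kerSection_span_dense] at htop
    exact fun f => htop trivial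
  refine ⟨k, hk2, fun f => ⟨(hall f).1, fun l => ?_⟩⟩
  have h := fun x => partialDeriv_eq h𝒳' ((hall f).2 l).1 ((hall f).2 l).2 x
  refine ⟨?_, h⟩
  rw [funext h]
  exact ((hall f).2 l).1

end Gradient

/-! ### Support recovery by thresholding empirical second moments -/

section Selection

variable {Z : Type*} [MeasurableSpace Z] {ρ : Measure Z} [IsProbabilityMeasure ρ]

/-- Hoeffding's inequality for the lower tail of an empirical mean of values in `[0, B]`. -/
lemma measure_sum_le_three_quarters {W : Z → ℝ} (hW : Measurable W) {B : ℝ} (hB : 0 < B)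
    (hWB : ∀ z, W z ∈ Set.Icc 0 B) (hpos : 0 ≤ ∫ z, W z ∂ρ) {n : ℕ} (hn : 1 ≤ n) :
    (Measure.pi fun _ : Fin n => ρ).real {z | ∑ i, W (z i) ≤ 3 / 4 * (n * ∫ z, W z ∂ρ)}
      ≤ Real.exp (-(n * (∫ z, W z ∂ρ) ^ 2 / (8 * B ^ 2))) := by
  set μ := Measure.pi fun _ : Fin n => ρ
  set S := ∫ z, W z ∂ρ with hS
  have hn' : (0 : ℝ) < n := by exact_mod_cast hn
  have hind : ProbabilityTheory.iIndepFun (fun (i : Fin n) (z : Fin n → Z) => S - W (z i)) μ :=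
    ProbabilityTheory.iIndepFun_pi (μ := fun _ : Fin n => ρ) (X := fun _ x => S - W x)
      fun _ => (hW.const_sub S).aemeasurable
  have hmean : ∀ i : Fin n, ∫ z, W (z i) ∂μ = S := fun i => by
    have hmp := measurePreserving_eval (fun _ : Fin n => ρ) i
    have h := integral_map (μ := μ) (f := W) hmp.measurable.aemeasurable hW.aestronglyMeasurable
    rw [hmp.map_eq] at h
    exact h.symm
  have hsub : ∀ i ∈ (Finset.univ : Finset (Fin n)), ProbabilityTheory.HasSubgaussianMGF
      (fun z : Fin n → Z => S - W (z i)) ((‖B - 0‖₊ / 2) ^ 2) μ := fun i _ => by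
    have h := (ProbabilityTheory.hasSubgaussianMGF_of_mem_Icc (μ := μ)
      (X := fun z : Fin n → Z => W (z i)) (a := 0) (b := B)
      (hW.comp (measurable_pi_apply i)).aemeasurable
      (Eventually.of_forall fun z => hWB _)).neg
    rw [hmean i] at h
    convert h using 1
    ext z
    simp
  -- Each summand has variance proxy `(B/2)^2`; the deviation `n S / 4` gives the exponent `n S^2 /
  -- (8 B^2)`.
  have h := ProbabilityTheory.HasSubgaussianMGF.measure_sum_ge_le_of_iIndepFun hind hsub
    (ε := n * S / 4) (by positivity)
  refine (measureReal_mono fun z hz => ?_).trans (h.trans (le_of_eq ?_))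
  · simp only [Set.mem_ofPred_eq, Finset.sum_sub_distrib, Finset.sum_const, Finset.card_univ,
      Fintype.card_fin, nsmul_eq_mul] at hz ⊢
    linarith
  · congr 1
    simp only [sub_zero, Finset.sum_const, Finset.card_univ, Fintype.card_fin, nsmul_eq_mul,
      NNReal.coe_mul, NNReal.coe_natCast, NNReal.coe_pow, NNReal.coe_div, coe_nnnorm,
      Real.norm_eq_abs, abs_of_pos hB, NNReal.coe_ofNat]
    field_simp
    ring

/-- If the functions `gh z l` approximate the `g l` uniformly up to `η` outside an exceptional
set, thresholding the empirical second moments of `gh` recovers the support of `g`. -/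
theorem measure_selection_ge {p n : ℕ} (hn : 1 ≤ n) {g : Fin p → Z → ℝ}
    (hg : ∀ l, Measurable (g l)) {B : ℝ} (hB : 0 < B) (hgB : ∀ l z, g l z ^ 2 ≤ B)
    {gh : (Fin n → Z) → Fin p → Z → ℝ} {bad : Set (Fin n → Z)} {η τ v : ℝ}
    (hη : ∀ z ∉ bad, ∀ l x, |gh z l x - g l x| ≤ η) (hv : η ^ 2 ≤ v) (hτ : 0 ≤ τ)
    (hA : ∀ l, 0 < ∫ x, g l x ^ 2 ∂ρ → τ ≤ ∫ x, g l x ^ 2 ∂ρ ∧ 2 * v ≤ ∫ x, g l x ^ 2 ∂ρ ∧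
      40 * η ^ 2 < ∫ x, g l x ^ 2 ∂ρ) :
    1 - (Measure.pi fun _ : Fin n => ρ).real bad
        - p * Real.exp (-(n * τ ^ 2 / (8 * B ^ 2)))
      ≤ (Measure.pi fun _ : Fin n => ρ).real
        {z | {l | v < (1 / (n : ℝ)) * ∑ i, gh z l (z i) ^ 2} = {l | 0 < ∫ x, g l x ^ 2 ∂ρ}} := by
  set μ := Measure.pi fun _ : Fin n => ρ
  set good : Set (Fin n → Z) :=
    {z | {l | v < (1 / (n : ℝ)) * ∑ i, gh z l (z i) ^ 2} = {l | 0 < ∫ x, g l x ^ 2 ∂ρ}}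
  have hn' : (0 : ℝ) < n := by exact_mod_cast hn
  have hint : ∀ l, Integrable (fun x => g l x ^ 2) ρ := fun l =>
    Integrable.of_bound ((hg l).pow_const 2).aestronglyMeasurable B
      (Eventually.of_forall fun x => by
        rw [Real.norm_eq_abs, abs_of_nonneg (sq_nonneg _)]; exact hgB l x)
  set dev : Fin p → Set (Fin n → Z) := fun l =>
    {z | 0 < ∫ x, g l x ^ 2 ∂ρ ∧ ∑ i, g l (z i) ^ 2 ≤ 3 / 4 * (n * ∫ x, g l x ^ 2 ∂ρ)}
  have hdev : ∀ l, μ.real (dev l) ≤ Real.exp (-(n * τ ^ 2 / (8 * B ^ 2))) := by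
    intro l
    by_cases hl : 0 < ∫ x, g l x ^ 2 ∂ρ
    · have h1 := measure_sum_le_three_quarters (ρ := ρ) ((hg l).pow_const 2) hB
        (fun z => ⟨sq_nonneg _, hgB l z⟩) hl.le hn
      refine (measureReal_mono fun z hz => hz.2).trans (h1.trans ?_)
      have := (hA l hl).1
      gcongr
    · have : dev l = ∅ := Set.eq_empty_of_forall_notMem fun z hz => hl hz.1
      rw [this, measureReal_empty]
      positivity
  set nul : Set (Fin n → Z) :=
    {z | ¬ ∀ l, ¬ 0 < ∫ x, g l x ^ 2 ∂ρ → ∀ i, g l (z i) = 0}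
  have hnul : μ.real nul = 0 := by
    have : ∀ᵐ z ∂μ, ∀ l, ¬ 0 < ∫ x, g l x ^ 2 ∂ρ → ∀ i, g l (z i) = 0 := by
      rw [ae_all_iff]; intro l
      by_cases hl : 0 < ∫ x, g l x ^ 2 ∂ρ
      · exact Eventually.of_forall fun z h => absurd hl h
      have h0 : ∫ x, g l x ^ 2 ∂ρ = 0 :=
        le_antisymm (not_lt.1 hl) (integral_nonneg fun x => sq_nonneg _)
      have h1 := (integral_eq_zero_iff_of_nonneg (fun x => sq_nonneg _) (hint l)).1 h0
      have h2 : ∀ i : Fin n, ∀ᵐ z ∂μ, g l (z i) = 0 := fun i => by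
        have hmp := measurePreserving_eval (fun _ : Fin n => ρ) i
        filter_upwards [hmp.quasiMeasurePreserving.ae h1] with z hz
        simpa using hz
      filter_upwards [ae_all_iff.2 h2] with z hz _ using hz
    rw [measureReal_def, ae_iff.1 this, ENNReal.toReal_zero]
  -- The good event need not be measurable, since `gh` is arbitrary in the sample. Its measure is
  -- bounded below by subadditivity over a cover, not by complementation.
  have hcover : (Set.univ : Set (Fin n → Z)) ⊆ ((good ∪ bad) ∪ ⋃ l, dev l) ∪ nul := by
    intro z _
    by_contra hz
    simp only [Set.mem_union, Set.mem_iUnion, not_or, not_exists] at hz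
    obtain ⟨⟨⟨hzg, hzb⟩, hzd⟩, hzn⟩ := hz
    have hzn' : ∀ l, ¬ 0 < ∫ x, g l x ^ 2 ∂ρ → ∀ i, g l (z i) = 0 := not_not.1 hzn
    have hηz := hη z hzb
    refine hzg (Set.ext fun l => ?_)
    change v < (1 / (n : ℝ)) * ∑ i, gh z l (z i) ^ 2 ↔ 0 < ∫ x, g l x ^ 2 ∂ρ
    have hsq : ∀ i, (gh z l (z i) - g l (z i)) ^ 2 ≤ η ^ 2 := fun i =>
      sq_le_sq' (abs_le.1 (hηz l (z i))).1 (abs_le.1 (hηz l (z i))).2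
    have hmul : (1 / (n : ℝ)) * ∑ i, gh z l (z i) ^ 2 = (∑ i, gh z l (z i) ^ 2) / n := by
      field_simp
    rw [hmul]
    constructor
    · intro h
      by_contra hl
      have h1 : ∑ i, gh z l (z i) ^ 2 ≤ n * η ^ 2 := by
        calc _ ≤ ∑ _i : Fin n, η ^ 2 := Finset.sum_le_sum fun i _ => by
              simpa [hzn' l hl i] using hsq i
          _ = n * η ^ 2 := by simp
      rw [lt_div_iff₀ hn'] at h
      nlinarith
    · intro hl
      obtain ⟨-, h2, h3⟩ := hA l hl
      have h4 : 3 / 4 * (n * ∫ x, g l x ^ 2 ∂ρ) < ∑ i, g l (z i) ^ 2 := by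
        by_contra h
        exact hzd l ⟨hl, not_lt.1 h⟩
      -- From `a² ≥ (4/5) b² - 4 (a - b)²`. With `h4` the empirical mean exceeds `(3/5) S - 4 η²`,
      -- where `S` is the true second moment, and `40 η² < S` leaves more than `S/2 ≥ v`.
      have h5 : 4 / 5 * ∑ i, g l (z i) ^ 2 - 4 * (n * η ^ 2) ≤ ∑ i, gh z l (z i) ^ 2 := by
        have : ∑ i : Fin n, (4 / 5 * g l (z i) ^ 2 - 4 * η ^ 2) ≤ ∑ i, gh z l (z i) ^ 2 := by
          refine Finset.sum_le_sum fun i _ => ?_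
          nlinarith [hsq i, sq_nonneg (5 * gh z l (z i) - 4 * g l (z i))]
        refine le_trans (le_of_eq ?_) this
        rw [Finset.sum_sub_distrib, ← Finset.mul_sum]
        simp
        ring
      rw [lt_div_iff₀ hn']
      nlinarith
  have h1 : (1 : ℝ) ≤ μ.real good + μ.real bad + ∑ l, μ.real (dev l) + μ.real nul := by
    calc (1 : ℝ) = μ.real Set.univ := by simp
      _ ≤ μ.real (((good ∪ bad) ∪ ⋃ l, dev l) ∪ nul) := measureReal_mono hcover
      _ ≤ μ.real ((good ∪ bad) ∪ ⋃ l, dev l) + μ.real nul := measureReal_union_le _ _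
      _ ≤ μ.real (good ∪ bad) + μ.real (⋃ l, dev l) + μ.real nul := by
        gcongr; exact measureReal_union_le _ _
      _ ≤ _ := by
        gcongr
        · exact measureReal_union_le _ _
        · exact measureReal_iUnion_fintype_le _
  have h2 : ∑ l, μ.real (dev l) ≤ p * Real.exp (-(n * τ ^ 2 / (8 * B ^ 2))) := by
    calc _ ≤ ∑ _l : Fin p, Real.exp (-(n * τ ^ 2 / (8 * B ^ 2))) :=
          Finset.sum_le_sum fun l _ => hdev l
      _ = _ := by simp
  linarith

end Selection

/-! ### Finite-sample recovery in the RKHS -/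

section FiniteSample

/-- Finite-sample lower bound for the probability of exact recovery of the active set. -/
theorem measure_selectedSet_eq_activeSet_ge {𝒴 : Set ℝ} {L : 𝒴 → ℝ → ℝ} {c₁ q : ℝ}
    (hL : AdmissibleLoss 𝒴 L c₁ q) {p : ℕ} {𝒳 : Set (EuclideanSpace ℝ (Fin p))}
    (h𝒳' : 𝒳 ⊆ closure (interior 𝒳)) {H : Type*} [NormedAddCommGroup H]
    [InnerProductSpace ℝ H] [CompleteSpace H] [RKHS ℝ H 𝒳 ℝ]
    (hK : ∀ y : 𝒳, HasContinuousPartials (fun x : 𝒳 => kerSection H x y))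
    {ρ : Measure (𝒳 × 𝒴)} [IsProbabilityMeasure ρ] {fstar : H} (hfstar : IsTarget L ρ fstar)
    {M : ℝ} (hM : ‖fstar‖ ≤ M) {lam : ℝ} (hlam : 0 < lam) (hlam1 : lam ≤ 1) {ftilde : H}
    (hftilde : IsRegularizedMinimizer L ρ lam ftilde) {n : ℕ} (hn : 1 ≤ n)
    {fhat : (Fin n → 𝒳 × 𝒴) → H} (hfhat : ∀ z, IsMEstimator L lam z (fhat z))
    {κ₁ κ₂ : ℝ} (hκ₁ : 0 < κ₁) (hκ₂ : 0 < κ₂) (hbdd : BoundedKernel 𝒳 H κ₁ κ₂)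
    {d M' : ℝ} (hd : ‖ftilde - fstar‖ ≤ d) (hM' : ‖ftilde‖ ≤ M') (hMM' : M ≤ M')
    {c : ℝ} (hc : 0 ≤ c)
    (hlip : ∀ y : 𝒴, ∀ w ∈ Set.Icc (-(κ₁ * (M' + 1))) (κ₁ * (M' + 1)),
      ∀ w' ∈ Set.Icc (-(κ₁ * (M' + 1))) (κ₁ * (M' + 1)), |L y w - L y w'| ≤ c * |w - w'|)
    {B : ℝ} (hB : 0 < B) (hMB : (κ₂ * M) ^ 2 ≤ B) {r τ v : ℝ} (hr : 0 < r)
    (hv : (κ₂ * (r + d)) ^ 2 ≤ v) (hτ : 0 ≤ τ)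
    (hA : ∀ l ∈ activeSet ρ fstar, τ ≤ gradNormSq ρ l fstar ∧ 2 * v ≤ gradNormSq ρ l fstar ∧
      40 * (κ₂ * (r + d)) ^ 2 < gradNormSq ρ l fstar) :
    1 - (c * κ₁ + 2 * M') ^ 2 / (n * lam ^ 2 * r ^ 2)
        - p * Real.exp (-(n * τ ^ 2 / (8 * B ^ 2)))
      ≤ (Measure.pi fun _ : Fin n => ρ).real
        {z | selectedSet z (fhat z) v = activeSet ρ fstar} := by
  obtain ⟨k, hk, hrep⟩ := exists_gradient_representer h𝒳' hK hbdd
  set Φ : 𝒳 × 𝒴 → H := fun z => kerSection H z.1 with hΦ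
  have hΦf : ∀ z (h : H), inner ℝ (Φ z) h = h z.1 := fun z h => inner_kerSection z.1 h
  have hfm : ∀ h : H, Measurable fun z : 𝒳 × 𝒴 => h z.1 := fun h =>
    (hrep h).1.measurable.comp measurable_fst
  have hΦm : ∀ h : H, Measurable fun z => inner ℝ (Φ z) h := fun h => by
    simp only [hΦf]; exact hfm h
  -- The kernel is continuous in one variable and measurable in the other, hence jointly measurable.
  have hΦ₂ : Measurable fun x : (𝒳 × 𝒴) × (𝒳 × 𝒴) => (inner ℝ (Φ x.1) (Φ x.2) : ℝ) := by
    have h1 : Measurable (Function.uncurry fun (x x' : 𝒳) => kerSection H x x') :=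
      measurable_uncurry_of_continuous_of_measurable (fun x' => (hK x').1)
        (fun x => (hrep (kerSection H x)).1.measurable)
    have h2 : ∀ x : (𝒳 × 𝒴) × (𝒳 × 𝒴), (inner ℝ (Φ x.1) (Φ x.2) : ℝ)
        = Function.uncurry (fun (x x' : 𝒳) => kerSection H x x') (x.2.1, x.1.1) :=
      fun x => hΦf _ _
    simp only [h2]
    exact h1.comp ((measurable_fst.comp measurable_snd).prodMk
      (measurable_fst.comp measurable_fst))
  have hΦκ : ∀ z, ‖Φ z‖ ≤ κ₁ := fun z => hbdd.1 z.1
  have hval : ∀ (z : 𝒳 × 𝒴) (h : H), ‖h‖ ≤ M' → |h z.1| ≤ κ₁ * (M' + 1) := fun z h hh => by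
    rw [← hΦf]
    refine (abs_real_inner_le_norm _ _).trans ?_
    exact mul_le_mul (hΦκ z) (by linarith) (norm_nonneg _) hκ₁.le
  have hLm : ∀ w, Measurable fun z : 𝒳 × 𝒴 => L z.2 w := fun w =>
    (hL.measurable w).comp measurable_snd
  have hLc : ∀ z : 𝒳 × 𝒴, ConvexOn ℝ Set.univ (L z.2) := fun z => hL.convex z.2
  have hint : Integrable (fun z => L z.2 (ftilde z.1)) ρ := by
    have hmt := measurable_comp_of_convex hLc hLm (hfm ftilde)
    have hms := measurable_comp_of_convex hLc hLm (hfm fstar)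
    -- Both functions take values in the interval of the Lipschitz bound, so the losses differ by a
    -- bounded amount and integrability passes from `fstar` to `ftilde`.
    have hdiff : Integrable (fun z => L z.2 (ftilde z.1) - L z.2 (fstar z.1)) ρ := by
      refine Integrable.of_bound (hmt.sub hms).aestronglyMeasurable
        (c * (κ₁ * (M' + 1) + κ₁ * (M' + 1))) (Eventually.of_forall fun z => ?_)
      have h1 := hval z ftilde hM'
      have h2 := hval z fstar (hM.trans hMM')
      refine (hlip z.2 _ (abs_le.1 h1) _ (abs_le.1 h2)).trans ?_
      gcongr
      exact (abs_sub _ _).trans (add_le_add h1 h2)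
    exact (hdiff.add hfstar.integrable).congr (Eventually.of_forall fun z => by simp)
  have hprob := measure_lt_norm_sub_le (ρ := ρ) hΦm hΦ₂ hκ₁ hΦκ (l := fun z => L z.2) hLc hLm
    (f := ftilde) hc hM' hlam hlam1 (fun z => hlip z.2) (by simpa only [hΦf] using hint)
    (by simp only [hΦf]; exact hftilde) hn (fh := fhat)
    (by simp only [hΦf]; exact fun z => hfhat z ftilde) hr
  set g : Fin p → 𝒳 × 𝒴 → ℝ := fun l z => partialDeriv l (fun x : 𝒳 => fstar x) z.1
  have hgrad : ∀ l, gradNormSq ρ l fstar = ∫ z, g l z ^ 2 ∂ρ := fun l =>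
    integral_map measurable_fst.aemeasurable
      (((hrep fstar).2 l).1.measurable.pow_const 2).aestronglyMeasurable
  have hsel := measure_selection_ge (ρ := ρ) hn (g := g)
    (fun l => ((hrep fstar).2 l).1.measurable.comp measurable_fst) hB
    (fun l z => by
      have h1 : |g l z| ≤ κ₂ * M := by
        change |partialDeriv l (fun x : 𝒳 => fstar x) z.1| ≤ _
        rw [((hrep fstar).2 l).2]
        exact (abs_real_inner_le_norm _ _).trans
          (mul_le_mul (hk l z.1) hM (norm_nonneg _) hκ₂.le)
      exact (sq_le_sq' (abs_le.1 h1).1 (abs_le.1 h1).2).trans hMB)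
    (gh := fun z l x => partialDeriv l (fun x : 𝒳 => fhat z x) x.1)
    (bad := {z | r < ‖fhat z - ftilde‖}) (η := κ₂ * (r + d)) (τ := τ) (v := v)
    (fun z hz l x => by
      change |partialDeriv l (fun x : 𝒳 => fhat z x) x.1
        - partialDeriv l (fun x : 𝒳 => fstar x) x.1| ≤ _
      rw [((hrep fstar).2 l).2, ((hrep (fhat z)).2 l).2, ← inner_sub_right]
      have h1 : ‖fhat z - ftilde‖ ≤ r := not_lt.1 hz
      have h2 : ‖fhat z - fstar‖ ≤ r + d := by
        have := norm_add_le (fhat z - ftilde) (ftilde - fstar)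
        rw [sub_add_sub_cancel] at this
        linarith
      exact (abs_real_inner_le_norm _ _).trans
        (mul_le_mul (hk l x.1) h2 (norm_nonneg _) hκ₂.le))
    hv hτ (fun l hl => by
      have := hA l (by rw [activeSet, Set.mem_ofPred_eq, hgrad]; exact hl)
      rwa [hgrad] at this)
  have hset : {z : Fin n → 𝒳 × 𝒴 | selectedSet z (fhat z) v = activeSet ρ fstar}
      = {z | {l | v < (1 / (n : ℝ)) * ∑ i, partialDeriv l (fun x : 𝒳 => fhat z x) (z i).1 ^ 2}
        = {l | 0 < ∫ x, g l x ^ 2 ∂ρ}} := by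
    simp only [selectedSet, activeSet, gradEmpNormSq, hgrad]
  rw [hset]
  linarith

end FiniteSample

/-! ### Comparison of the rates -/

section Rates

lemma regParam_pos {q : ℝ} {n : ℕ} (hn : 1 ≤ n) : 0 < regParam q n :=
  Real.rpow_pos_of_pos (by exact_mod_cast hn) _

lemma regParam_le_one {q : ℝ} (hq : 1 ≤ q) {n : ℕ} (hn : 1 ≤ n) : regParam q n ≤ 1 :=
  Real.rpow_le_one_of_one_le_of_nonpos (by exact_mod_cast hn)
    (neg_nonpos.2 (by positivity))

lemma regParam_rpow (q θ : ℝ) (n : ℕ) : regParam q n ^ θ = (n : ℝ) ^ (-(θ / (4 * q))) := by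
  rw [regParam, ← Real.rpow_mul (Nat.cast_nonneg n)]
  congr 1
  ring

lemma le_rate {q : ℝ} (hq : 1 ≤ q) (θ : ℝ) {n : ℕ} (hn : 3 ≤ n) :
    (n : ℝ) ^ (-(3 / 16 : ℝ)) ≤ rate q θ n := by
  refine le_max_of_le_left ?_
  have h1 : 1 ≤ Real.log n := by
    rw [Real.le_log_iff_exp_le (by positivity)]
    have : (3 : ℝ) ≤ n := by exact_mod_cast hn
    linarith [Real.exp_one_lt_d9]
  have h2 : 1 ≤ Real.log n ^ (q / 2) := Real.one_le_rpow h1 (by linarith)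
  exact le_mul_of_one_le_left (Real.rpow_nonneg (Nat.cast_nonneg n) _) h2

lemma tendsto_natCast_rpow_neg {a : ℝ} (ha : 0 < a) :
    Tendsto (fun n : ℕ => (n : ℝ) ^ (-a)) atTop (𝓝 0) :=
  (tendsto_rpow_neg_atTop ha).comp tendsto_natCast_atTop_atTop

/-- The squared estimation error is of smaller order than the thresholding rate. -/
lemma eventually_sq_le_mul_rate {q θ : ℝ} (hq : 1 ≤ q) (hθ : 0 < θ) (κ c₃ : ℝ) {ε : ℝ}
    (hε : 0 < ε) :
    ∀ᶠ n : ℕ in atTop, (κ * ((n : ℝ) ^ (-(1 / 8 : ℝ)) + c₃ * regParam q n ^ θ)) ^ 2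
      ≤ ε * rate q θ n := by
  have hlim : Tendsto (fun n : ℕ => 2 * κ ^ 2 * ((n : ℝ) ^ (-(1 / 16 : ℝ))
      + c₃ ^ 2 * (n : ℝ) ^ (-(θ / (4 * q))))) atTop (𝓝 0) := by
    have h1 := tendsto_natCast_rpow_neg (a := 1 / 16) (by norm_num)
    have h2 := tendsto_natCast_rpow_neg (a := θ / (4 * q)) (by positivity)
    simpa using (h1.add (h2.const_mul (c₃ ^ 2))).const_mul (2 * κ ^ 2)
  filter_upwards [hlim.eventually_le_const hε, eventually_ge_atTop 3] with n hn hn3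
  have hn' : (0 : ℝ) < n := by positivity
  have hr1 := le_rate hq θ hn3
  have hr2 : (n : ℝ) ^ (-(θ / (4 * q))) ≤ rate q θ n := le_max_right _ _
  have hr0 : 0 ≤ rate q θ n := (Real.rpow_nonneg hn'.le _).trans hr2
  rw [regParam_rpow]
  set b := (n : ℝ) ^ (-(θ / (4 * q)))
  have hb : 0 ≤ b := Real.rpow_nonneg hn'.le _
  -- Each squared error term factors into a piece bounded by `rate` and a piece tending to zero:
  -- here `n^(-1/16)`, and one factor `b` of `b * b` below.
  have ha : ((n : ℝ) ^ (-(1 / 8 : ℝ))) ^ 2 = (n : ℝ) ^ (-(1 / 16 : ℝ)) * (n : ℝ) ^ (-(3 / 16 : ℝ)) := by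
    rw [← Real.rpow_natCast, ← Real.rpow_mul hn'.le, ← Real.rpow_add hn']
    norm_num
  calc (κ * ((n : ℝ) ^ (-(1 / 8 : ℝ)) + c₃ * b)) ^ 2
      ≤ 2 * κ ^ 2 * (((n : ℝ) ^ (-(1 / 8 : ℝ))) ^ 2 + c₃ ^ 2 * b * b) := by
        nlinarith [mul_nonneg (sq_nonneg κ) (sq_nonneg ((n : ℝ) ^ (-(1 / 8 : ℝ)) - c₃ * b))]
    _ ≤ 2 * κ ^ 2 * ((n : ℝ) ^ (-(1 / 16 : ℝ)) * rate q θ n + c₃ ^ 2 * b * rate q θ n) := by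
        rw [ha]; gcongr
    _ = 2 * κ ^ 2 * ((n : ℝ) ^ (-(1 / 16 : ℝ)) + c₃ ^ 2 * b) * rate q θ n := by ring
    _ ≤ ε * rate q θ n := by gcongr

/-- The exponent on the right is `1 - 1/(2q) - 1/4`, at least `1/4` since `q ≥ 1`. This is the
denominator in the Chebyshev bound. -/
lemma rpow_quarter_le {q : ℝ} (hq : 1 ≤ q) {n : ℕ} (hn : 1 ≤ n) :
    (n : ℝ) ^ (1 / 4 : ℝ) ≤ n * regParam q n ^ 2 * ((n : ℝ) ^ (-(1 / 8 : ℝ))) ^ 2 := by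
  have hn1 : (1 : ℝ) ≤ n := by exact_mod_cast hn
  have hn' : (0 : ℝ) < n := by linarith
  have : n * regParam q n ^ 2 * ((n : ℝ) ^ (-(1 / 8 : ℝ))) ^ 2
      = (n : ℝ) ^ (1 + (-(1 / (4 * q))) * 2 + (-(1 / 8 : ℝ)) * 2) := by
    rw [regParam, ← Real.rpow_natCast, ← Real.rpow_natCast, ← Real.rpow_mul hn'.le,
      ← Real.rpow_mul hn'.le, Real.rpow_add hn', Real.rpow_add hn', Real.rpow_one]
    norm_num
  rw [this]
  refine Real.rpow_le_rpow_of_exponent_le hn1 ?_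
  have : 1 / (4 * q) ≤ 1 / 4 := by
    apply one_div_le_one_div_of_le <;> linarith
  linarith

lemma one_le_log_four_div {δ : ℝ} (hδ : 0 < δ) (hδ1 : δ < 1) : 1 ≤ Real.log (4 / δ) := by
  rw [Real.le_log_iff_exp_le (by positivity), le_div_iff₀ hδ]
  nlinarith [Real.exp_one_lt_d9, Real.exp_pos 1]

/-- The union bound over the coordinates is absorbed by the logarithmic factor of the signal. -/
lemma mul_exp_neg_le {q θ ξ c₅ Λ B : ℝ} (hq : 1 ≤ q) (hξ : 1 / 2 < ξ) (hc₅ : 0 < c₅)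
    (hΛ : 1 ≤ Λ) (hB : 0 < B) {p n : ℕ} (hp : 0 < p) (hpΛ : Real.log p ≤ Λ) (hn : 3 ≤ n)
    (ha : 1 ≤ c₅ ^ 2 / (8 * B ^ 2) * (n : ℝ) ^ (5 / 8 : ℝ)) :
    p * Real.exp (-(n * (c₅ * Λ ^ ξ * rate q θ n) ^ 2 / (8 * B ^ 2)))
      ≤ Real.exp (-(c₅ ^ 2 / (8 * B ^ 2) * (n : ℝ) ^ (5 / 8 : ℝ) - 1)) := by
  have hn' : (0 : ℝ) < n := by positivity
  have hp' : (0 : ℝ) < p := by exact_mod_cast hp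
  -- Here `ξ > 1/2` and `Λ ≥ 1` enter.
  have h1 : Λ ≤ (Λ ^ ξ) ^ 2 := by
    rw [← Real.rpow_natCast, ← Real.rpow_mul (by linarith)]
    calc Λ = Λ ^ (1 : ℝ) := (Real.rpow_one Λ).symm
      _ ≤ _ := Real.rpow_le_rpow_of_exponent_le hΛ (by push_cast; linarith)
  have h2 : (n : ℝ) ^ (5 / 8 : ℝ) ≤ n * rate q θ n ^ 2 := by
    calc (n : ℝ) ^ (5 / 8 : ℝ) = n * ((n : ℝ) ^ (-(3 / 16 : ℝ))) ^ 2 := by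
          rw [← Real.rpow_natCast, ← Real.rpow_mul hn'.le]
          nth_rewrite 2 [← Real.rpow_one (n : ℝ)]
          rw [← Real.rpow_add hn']
          norm_num
      _ ≤ _ := by gcongr; exact le_rate hq θ hn
  set a := c₅ ^ 2 / (8 * B ^ 2) * (n : ℝ) ^ (5 / 8 : ℝ) with hadef
  have h3 : a * Λ ≤ n * (c₅ * Λ ^ ξ * rate q θ n) ^ 2 / (8 * B ^ 2) := by
    calc a * Λ = c₅ ^ 2 / (8 * B ^ 2) * ((n : ℝ) ^ (5 / 8 : ℝ) * Λ) := by rw [hadef]; ring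
      _ ≤ c₅ ^ 2 / (8 * B ^ 2) * (n * rate q θ n ^ 2 * (Λ ^ ξ) ^ 2) := by gcongr
      _ = _ := by ring
  calc p * Real.exp (-(n * (c₅ * Λ ^ ξ * rate q θ n) ^ 2 / (8 * B ^ 2)))
      = Real.exp (Real.log p - n * (c₅ * Λ ^ ξ * rate q θ n) ^ 2 / (8 * B ^ 2)) := by
        rw [sub_eq_add_neg, Real.exp_add, Real.exp_log hp']
    -- `log p - a Λ ≤ (1 - a) Λ ≤ 1 - a`, since `a ≥ 1` and `Λ ≥ 1`.
    _ ≤ _ := Real.exp_le_exp.2 (by nlinarith)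

end Rates

end SparseRKHS

/-! ### Passage to the limit -/

theorem theorem2
    -- the loss
    (𝒴 : Set ℝ) (L : 𝒴 → ℝ → ℝ) (c₁ q : ℝ) (hc₁ : 0 < c₁) (hq : 1 ≤ q)
    (hL : AdmissibleLoss 𝒴 L c₁ q)
    -- for every sample size `n`: dimension, covariate domain, RKHS, and law of `(x, y)`
    (p : ℕ → ℕ) (hp : ∀ n, 0 < p n)
    (𝒳 : ∀ n, Set (EuclideanSpace ℝ (Fin (p n))))
    (h𝒳 : ∀ n, IsCompact (𝒳 n)) (h𝒳' : ∀ n, 𝒳 n ⊆ closure (interior (𝒳 n)))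
    (H : ℕ → Type*) [∀ n, NormedAddCommGroup (H n)] [∀ n, InnerProductSpace ℝ (H n)]
    [∀ n, CompleteSpace (H n)] [∀ n, RKHS ℝ (H n) (𝒳 n) ℝ]
    (hK : ∀ n, ∀ y : 𝒳 n,
      HasContinuousPartials (fun x : 𝒳 n => kerSection (H n) x y))
    (ρ : ∀ n, Measure (𝒳 n × 𝒴)) [∀ n, IsProbabilityMeasure (ρ n)]
    (hY : ∀ n, Integrable (fun z : 𝒳 n × 𝒴 => (z.2 : ℝ)) (ρ n))
    -- target functions, with bounded norms
    (fstar : ∀ n, H n) (hfstar : ∀ n, IsTarget L (ρ n) (fstar n))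
    (M : ℝ) (hM : ∀ n, ‖fstar n‖ ≤ M)
    -- population and empirical regularized minimizers
    (ftilde : ∀ n, H n)
    (hftilde : ∀ n, 1 ≤ n → IsRegularizedMinimizer L (ρ n) (regParam q n) (ftilde n))
    (fhat : ∀ n, (Fin n → 𝒳 n × 𝒴) → H n)
    (hfhat : ∀ n, 1 ≤ n → ∀ z, IsMEstimator L (regParam q n) z (fhat n z))
    -- bounded kernel and kernel gradients
    (κ₁ κ₂ : ℝ) (hκ₁ : 0 < κ₁) (hκ₂ : 0 < κ₂)
    (hbdd : ∀ n, BoundedKernel (𝒳 n) (H n) κ₁ κ₂)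
    -- approximation error
    (c₃ θ : ℝ) (hc₃ : 0 < c₃) (hθ : 0 < θ)
    (happrox : ∀ n, 1 ≤ n → ‖ftilde n - fstar n‖ ≤ c₃ * regParam q n ^ θ)
    -- confidence levels
    (δ : ℕ → ℝ) (hδ : ∀ᶠ n in atTop, 0 < δ n ∧ δ n < 1 ∧
      2 * Real.log n ^ (-(1 / q)) * ∫ z, |(z.2 : ℝ)| ∂(ρ n) ≤ δ n)
    -- minimal signal strength
    (c₅ ξ : ℝ) (hc₅ : 0 < c₅) (hξ : 1 / 2 < ξ)
    (hsignal : ∀ᶠ n in atTop, ∀ l ∈ activeSet (ρ n) (fstar n),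
      c₅ * Real.log (4 * p n / δ n) ^ ξ * rate q θ n < gradNormSq (ρ n) l (fstar n)) :
    Tendsto (fun n => (Measure.pi fun _ : Fin n => ρ n)
        {z | selectedSet z (fhat n z) (c₅ / 2 * Real.log (4 / δ n) ^ ξ * rate q θ n)
          = activeSet (ρ n) (fstar n)})
      atTop (𝓝 1) ∧
    Tendsto (fun n => (Measure.pi fun _ : Fin n => ρ n)
        {z | selectedSet z (fhat n z) (c₅ / 2 * Real.log (4 * p n / δ n) ^ ξ * rate q θ n)
          = activeSet (ρ n) (fstar n)})
      atTop (𝓝 1) := by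
  -- As `λ_n ≤ 1`, `‖ftilde n‖ ≤ M + c₃`; the extra `1` is the room for perturbations in the
  -- difference quotients.
  obtain ⟨c, hc, hlip⟩ := hL.lipschitz (κ₁ * (M + c₃ + 1)) (by
    have := (norm_nonneg _).trans (hM 0)
    positivity)
  set A := fun n => activeSet (ρ n) (fstar n)
  set d : ℕ → ℝ := fun n => c₃ * regParam q n ^ θ
  -- Small enough that `r²` is of smaller order than `n^(-3/16)`, large enough that `n λ² r² ≥
  -- n^(1/4)`.
  set r : ℕ → ℝ := fun n => (n : ℝ) ^ (-(1 / 8 : ℝ))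
  set B : ℝ := (κ₂ * M) ^ 2 + 1 with hBdef
  have hB : 0 < B := by positivity
  set Λ : ℕ → ℝ := fun n => Real.log (4 * p n / δ n) with hΛdef
  have hΛ : ∀ᶠ n in atTop, 1 ≤ Real.log (4 / δ n) ∧ Real.log (4 / δ n) ≤ Λ n ∧
      Real.log (p n) ≤ Λ n := by
    filter_upwards [hδ] with n ⟨h0, h1, _⟩
    have hpn : (1 : ℝ) ≤ p n := by exact_mod_cast hp n
    have h4 : (4 : ℝ) ≤ 4 / δ n := by rw [le_div_iff₀ h0]; linarith
    refine ⟨one_le_log_four_div h0 h1, Real.log_le_log (by positivity) ?_,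
      Real.log_le_log (by positivity) ?_⟩
    · gcongr; linarith
    · rw [mul_div_right_comm]; nlinarith
  -- Any threshold between the squared derivative error and half the signal works.
  have main : ∀ v : ℕ → ℝ, (∀ᶠ n in atTop, (κ₂ * (r n + d n)) ^ 2 ≤ v n ∧
      ∀ l ∈ A n, 2 * v n ≤ gradNormSq (ρ n) l (fstar n)) →
      Tendsto (fun n => (Measure.pi fun _ : Fin n => ρ n)
        {z | selectedSet z (fhat n z) (v n) = activeSet (ρ n) (fstar n)}) atTop (𝓝 1) := by
    intro v hv
    set a : ℕ → ℝ := fun n => c₅ ^ 2 / (8 * B ^ 2) * (n : ℝ) ^ (5 / 8 : ℝ)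
    have ha : Tendsto a atTop atTop :=
      ((tendsto_rpow_atTop (by norm_num)).comp tendsto_natCast_atTop_atTop).const_mul_atTop
        (by positivity)
    have hlow : Tendsto (fun n : ℕ => 1 - (c * κ₁ + 2 * (M + c₃)) ^ 2 * (n : ℝ) ^ (-(1 / 4 : ℝ))
        - Real.exp (-(a n - 1))) atTop (𝓝 1) := by
      have h1 := (tendsto_natCast_rpow_neg (a := 1 / 4) (by norm_num)).const_mul
        ((c * κ₁ + 2 * (M + c₃)) ^ 2)
      have h2 : Tendsto (fun n => Real.exp (-(a n - 1))) atTop (𝓝 0) :=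
        Real.tendsto_exp_neg_atTop_nhds_zero.comp (tendsto_atTop_add_const_right _ (-1) ha)
      simpa using (h1.const_sub 1).sub h2
    have hreal : Tendsto (fun n => (Measure.pi fun _ : Fin n => ρ n).real
        {z | selectedSet z (fhat n z) (v n) = activeSet (ρ n) (fstar n)}) atTop (𝓝 1) := by
      refine tendsto_of_tendsto_of_tendsto_of_le_of_le' hlow tendsto_const_nhds ?_
        (Eventually.of_forall fun n => measureReal_le_one)
      filter_upwards [hv, hΛ, hsignal, eventually_ge_atTop 3, ha.eventually_ge_atTop 1,
        eventually_sq_le_mul_rate hq hθ κ₂ c₃ (ε := c₅ / 40) (by positivity)]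
        with n ⟨hv1, hv2⟩ ⟨hΛ1, hΛ2, hΛp⟩ hS hn3 han herr
      have hn1 : 1 ≤ n := by omega
      have hn' : (0 : ℝ) < n := by positivity
      have hrate : 0 ≤ rate q θ n := (Real.rpow_nonneg hn'.le _).trans (le_max_right _ _)
      have hΛξ : 1 ≤ Λ n ^ ξ := Real.one_le_rpow (hΛ1.trans hΛ2) (by linarith)
      have hd1 : d n ≤ c₃ :=
        mul_le_of_le_one_right hc₃.le
          (Real.rpow_le_one (regParam_pos hn1).le (regParam_le_one hq hn1) hθ.le)
      have hft : ‖ftilde n‖ ≤ M + c₃ := by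
        have h1 := norm_add_le (ftilde n - fstar n) (fstar n)
        rw [sub_add_cancel] at h1
        linarith [happrox n hn1, hM n]
      have hfin := measure_selectedSet_eq_activeSet_ge hL (h𝒳' n) (hK n) (hfstar n) (hM n)
        (regParam_pos hn1) (regParam_le_one hq hn1) (hftilde n hn1) hn1 (hfhat n hn1) hκ₁ hκ₂
        (hbdd n) (happrox n hn1) hft (by linarith) hc.le hlip hB (by linarith)
        (r := r n) (τ := c₅ * Λ n ^ ξ * rate q θ n) (v := v n) (Real.rpow_pos_of_pos hn' _) hv1
        (by positivity) (fun l hl => ⟨(hS l hl).le, hv2 l hl, lt_of_le_of_lt ?_ (hS l hl)⟩)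
      · refine le_trans ?_ hfin
        have e1 : (c * κ₁ + 2 * (M + c₃)) ^ 2 / (n * regParam q n ^ 2 * r n ^ 2)
            ≤ (c * κ₁ + 2 * (M + c₃)) ^ 2 * (n : ℝ) ^ (-(1 / 4 : ℝ)) := by
          rw [Real.rpow_neg hn'.le, ← div_eq_mul_inv]
          have := Real.rpow_pos_of_pos hn' (1 / 4 : ℝ)
          gcongr
          exact rpow_quarter_le hq hn1
        have e2 := mul_exp_neg_le (θ := θ) hq hξ hc₅ (hΛ1.trans hΛ2) hB (hp n) hΛp hn3 han
        linarith
      · calc 40 * (κ₂ * (r n + d n)) ^ 2 ≤ 40 * (c₅ / 40 * rate q θ n) := by gcongr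
          _ = c₅ * 1 * rate q θ n := by ring
          _ ≤ c₅ * Λ n ^ ξ * rate q θ n := by gcongr
    have := ENNReal.tendsto_ofReal hreal
    rw [ENNReal.ofReal_one] at this
    refine this.congr fun n => ?_
    exact ENNReal.ofReal_toReal (measure_ne_top _ _)
  constructor
  -- Both thresholds lie between `c₅/2 * rate` and `c₅/2 * Λ^ξ * rate`: the former dominates the
  -- squared error, the latter is half the assumed signal bound.
  all_goals
    refine main _ ?_
    filter_upwards [hΛ, hsignal, eventually_ge_atTop 3,
      eventually_sq_le_mul_rate hq hθ κ₂ c₃ (ε := c₅ / 2) (by positivity)]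
      with n ⟨hΛ1, hΛ2, _⟩ hS hn3 herr
    have hrate : 0 ≤ rate q θ n :=
      (Real.rpow_nonneg (Nat.cast_nonneg n) _).trans (le_max_right _ _)
    have h1 : 1 ≤ Real.log (4 / δ n) ^ ξ := Real.one_le_rpow hΛ1 (by linarith)
    have h2 : Real.log (4 / δ n) ^ ξ ≤ Λ n ^ ξ :=
      Real.rpow_le_rpow (by linarith) hΛ2 (by linarith)
    have h3 : c₅ / 2 * rate q θ n ≤ c₅ / 2 * Real.log (4 / δ n) ^ ξ * rate q θ n := by
      gcongr; exact le_mul_of_one_le_right (by positivity) h1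
    have h4 : c₅ / 2 * Real.log (4 / δ n) ^ ξ * rate q θ n ≤ c₅ / 2 * Λ n ^ ξ * rate q θ n := by
      gcongr
    refine ⟨by linarith, fun l hl => ?_⟩
    have := hS l hl
    linarith
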